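/- Let $k$ be a field and let $A=\bigoplus_{i\ge 0}A_i$ be an associative graded $k$-algebra with $A_0=k$. Assume that $A$ is generated by $A_1$ over $k$ with finitely many defining relations, i.e. the canonical homomorphism $T(A_1)\to A$ from the tensor algebra of $A_1$ is surjective and its kernel is finitely generated as a two-sided ideal. Let $n\ge 1$ be an integer and let $A^{(n)}=\bigoplus_{i\ge 0}A_{in}$ be the Veronese subalgebra, graded so that its component of degree $i$ is $A_{in}$. Then $A$ is coherent if and only if $A^{(n)}$ is coherent. Here, for a graded algebra $B=\bigoplus_{i\ge 0}B_i$ with $B_0=k$ and $j\in\mathbb Z$, $B(j)$ denotes the free graded right module with $B(j)_i=B_{i+j}$, and $S_j$ denotes the one-dimensional graded right module $k=B/\bigoplus_{i>0}B_i$ placed in degree $j$. A graded right $B$-module $M$ is finitely generated if there is a surjective degree-preserving homomorphism $P\to M$ with $P$ a finite direct sum of modules $B(j)$. It is coherent if it is finitely generated and the kernel of every degree-preserving homomorphism $P\to M$, with $P$ a finite direct sum of modules $B(j)$, is finitely generated. The algebra $B$ is coherent if all the graded right modules $B(j)$ and $S_j$, $j\in\mathbb Z$, are coherent. -/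

import Mathlib

open scoped DirectSum

/-- A nonnegatively graded `k`-algebra is connected if `A₀ = k`. -/
def IsConnectedGraded {k A : Type*} [Field k] [Ring A] [Algebra k A]
    (𝒜 : ℕ → Submodule k A) [GradedAlgebra 𝒜] : Prop :=
  Function.Injective (algebraMap k A) ∧ 𝒜 0 = LinearMap.range (Algebra.linearMap k A)

/-- The canonical homomorphism `T(A₁) → A` from the tensor algebra of the degree-one component. -/
noncomputable def tensorToAlgebra {k A : Type*} [Field k] [Ring A] [Algebra k A]
    (𝒜 : ℕ → Submodule k A) : TensorAlgebra k (𝒜 1) →ₐ[k] A :=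
  TensorAlgebra.lift k (𝒜 1).subtype

/-- `A` is generated by `A₁` as a `k`-algebra. -/
def GeneratedInDegreeOne {k A : Type*} [Field k] [Ring A] [Algebra k A]
    (𝒜 : ℕ → Submodule k A) : Prop :=
  Algebra.adjoin k (𝒜 1 : Set A) = ⊤

/-- The two-sided ideal of relations between the generators `A₁` of `A`, that is, the kernel of
`T(A₁) → A`, is generated by a finite set. -/
def HasFinitelyManyRelations {k A : Type*} [Field k] [Ring A] [Algebra k A]
    (𝒜 : ℕ → Submodule k A) : Prop :=
  ∃ R : Set (TensorAlgebra k (𝒜 1)), R.Finite ∧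
    TwoSidedIdeal.span R = TwoSidedIdeal.ker (tensorToAlgebra 𝒜)

/-! Right `A`-modules are modules over `Aᵐᵒᵖ`; a graded right module is a right module `M`
together with its family of homogeneous components `ℳ : ℤ → AddSubgroup M`. -/

/-- The components of `A` indexed by all integers: `A_i = 0` for `i < 0`. -/
def intPiece {k A : Type*} [Field k] [Ring A] [Algebra k A]
    (𝒜 : ℕ → Submodule k A) : ℤ → Submodule k A
  | Int.ofNat i => 𝒜 i
  | Int.negSucc _ => ⊥

/-- The grading of the shifted free right module `A(j)`, with `A(j)_i = A_{i+j}`. -/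
def shiftPiece {k A : Type*} [Field k] [Ring A] [Algebra k A]
    (𝒜 : ℕ → Submodule k A) (j i : ℤ) : AddSubgroup A :=
  (intPiece 𝒜 (i + j)).toAddSubgroup

/-- The grading of the finite direct sum `A(d₁) ⊕ ⋯ ⊕ A(d_r)`, whose underlying right module
is `A^r`. -/
def freePiece {k A : Type*} [Field k] [Ring A] [Algebra k A]
    (𝒜 : ℕ → Submodule k A) {r : ℕ} (d : Fin r → ℤ) (i : ℤ) : AddSubgroup (Fin r → A) :=
  AddSubgroup.pi Set.univ (fun s => shiftPiece 𝒜 (d s) i)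

/-- A homomorphism of right modules that preserves degrees. -/
def IsGradedHom {A M N : Type*} [Ring A] [AddCommGroup M] [AddCommGroup N]
    [Module Aᵐᵒᵖ M] [Module Aᵐᵒᵖ N] (ℳ : ℤ → AddSubgroup M) (𝒩 : ℤ → AddSubgroup N)
    (f : M →ₗ[Aᵐᵒᵖ] N) : Prop :=
  ∀ i : ℤ, ∀ x ∈ ℳ i, f x ∈ 𝒩 i

/-- A graded right module is finitely generated if it receives a surjective graded homomorphism
from some `A(d₁) ⊕ ⋯ ⊕ A(d_r)`. -/
def IsFinitelyGeneratedGraded {k A M : Type*} [Field k] [Ring A] [Algebra k A]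
    (𝒜 : ℕ → Submodule k A) [AddCommGroup M] [Module Aᵐᵒᵖ M] (ℳ : ℤ → AddSubgroup M) : Prop :=
  ∃ (r : ℕ) (d : Fin r → ℤ) (f : (Fin r → A) →ₗ[Aᵐᵒᵖ] M),
    IsGradedHom (freePiece 𝒜 d) ℳ f ∧ Function.Surjective f

/-- The grading induced on a submodule. -/
def inducedPiece {A M : Type*} [Ring A] [AddCommGroup M] [Module Aᵐᵒᵖ M]
    (ℳ : ℤ → AddSubgroup M) (N : Submodule Aᵐᵒᵖ M) (i : ℤ) : AddSubgroup N :=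
  (ℳ i).comap N.subtype.toAddMonoidHom

/-- A graded right module `M` is coherent if it is finitely generated and the kernel of every
graded homomorphism `A(d₁) ⊕ ⋯ ⊕ A(d_r) → M` is finitely generated. -/
def IsCoherentGraded {k A M : Type*} [Field k] [Ring A] [Algebra k A]
    (𝒜 : ℕ → Submodule k A) [AddCommGroup M] [Module Aᵐᵒᵖ M] (ℳ : ℤ → AddSubgroup M) : Prop :=
  IsFinitelyGeneratedGraded 𝒜 ℳ ∧
    ∀ (r : ℕ) (d : Fin r → ℤ) (f : (Fin r → A) →ₗ[Aᵐᵒᵖ] M),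
      IsGradedHom (freePiece 𝒜 d) ℳ f →
        IsFinitelyGeneratedGraded 𝒜 (inducedPiece (freePiece 𝒜 d) (LinearMap.ker f))

/-- The augmentation ideal `A₊`, as a right ideal. It is the right ideal generated by
all elements of positive degree, which for a graded algebra is `⊕_{i > 0} A_i`. -/
def augmentationIdeal {k A : Type*} [Field k] [Ring A] [Algebra k A]
    (𝒜 : ℕ → Submodule k A) : Submodule Aᵐᵒᵖ A :=
  Submodule.span Aᵐᵒᵖ {a | ∃ i : ℕ, 0 < i ∧ a ∈ 𝒜 i}

/-- The grading of the module `S_j`: for connected `A` it is `A / A₊ = k`, placed in degree `j`. -/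
def simplePiece {k A : Type*} [Field k] [Ring A] [Algebra k A]
    (𝒜 : ℕ → Submodule k A) (j i : ℤ) : AddSubgroup (A ⧸ augmentationIdeal 𝒜) :=
  if i = j then ⊤ else ⊥

/-- A graded algebra is (right) coherent if all the graded right modules `A(j)` and `S_j`
are coherent. -/
def IsCoherentGradedAlgebra {k A : Type*} [Field k] [Ring A] [Algebra k A]
    (𝒜 : ℕ → Submodule k A) [GradedAlgebra 𝒜] : Prop :=
  (∀ j : ℤ, IsCoherentGraded 𝒜 (shiftPiece 𝒜 j)) ∧
    ∀ j : ℤ, IsCoherentGraded 𝒜 (simplePiece 𝒜 j)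

/-- The Veronese subalgebra `A^{(n)} = ⊕ A_{in}` : the elements all of whose homogeneous
components live in degrees divisible by `n`. -/
def veronese {k A : Type*} [Field k] [Ring A] [Algebra k A]
    (𝒜 : ℕ → Submodule k A) [GradedAlgebra 𝒜] (n : ℕ) : Subalgebra k A where
  carrier := {a | ∀ i : ℕ, ¬ n ∣ i → (DirectSum.decompose 𝒜 a i : A) = 0}
  mul_mem' := by
    intro a b ha hb i hi
    classical
    rw [DirectSum.decompose_mul, DirectSum.coe_mul_apply]
    refine Finset.sum_eq_zero fun p hp => ?_
    obtain ⟨-, hp⟩ := Finset.mem_filter.mp hp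
    by_cases h1 : n ∣ p.1
    · have h2 : ¬ n ∣ p.2 := fun h2 => hi (hp ▸ dvd_add h1 h2)
      rw [hb _ h2, mul_zero]
    · rw [ha _ h1, zero_mul]
  add_mem' := by
    intro a b ha hb i hi
    simp [DirectSum.decompose_add, ha i hi, hb i hi]
  algebraMap_mem' := by
    intro c i hi
    have h0 : (0 : ℕ) ≠ i := by rintro rfl; exact hi (dvd_zero n)
    exact DirectSum.decompose_of_mem_ne 𝒜 (SetLike.algebraMap_mem_graded 𝒜 c) h0

/-- The grading of the Veronese subalgebra: its component of degree `i` is `A_{in}`. -/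
def veronesePiece {k A : Type*} [Field k] [Ring A] [Algebra k A]
    (𝒜 : ℕ → Submodule k A) [GradedAlgebra 𝒜] (n : ℕ) (i : ℕ) : Submodule k (veronese 𝒜 n) :=
  (𝒜 (i * n)).comap (veronese 𝒜 n).val.toLinearMap

theorem mem_veronese_of_mem {k A : Type*} [Field k] [Ring A] [Algebra k A]
    (𝒜 : ℕ → Submodule k A) [GradedAlgebra 𝒜] (n i : ℕ) {a : A} (ha : a ∈ 𝒜 (i * n)) :
    a ∈ veronese 𝒜 n := by
  intro j hj
  have h0 : i * n ≠ j := by rintro rfl; exact hj (dvd_mul_left n i)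
  exact DirectSum.decompose_of_mem_ne 𝒜 ha h0

theorem veronesePiece_isInternal {k A : Type*} [Field k] [Ring A] [Algebra k A]
    (𝒜 : ℕ → Submodule k A) [GradedAlgebra 𝒜] (n : ℕ) [NeZero n] :
    DirectSum.IsInternal (veronesePiece 𝒜 n) := by
  classical
  rw [DirectSum.isInternal_submodule_iff_iSupIndep_and_iSup_eq_top]
  constructor
  · have h1 : iSupIndep (fun i : ℕ => 𝒜 (i * n)) :=
      (DirectSum.Decomposition.isInternal 𝒜).submodule_iSupIndep.comp
        (f := fun i : ℕ => i * n) (fun _ _ h => Nat.eq_of_mul_eq_mul_right (NeZero.pos n) h)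
    rw [iSupIndep_def] at h1 ⊢
    intro i
    rw [Submodule.disjoint_def]
    intro x hx hx'
    refine Subtype.ext (Submodule.disjoint_def.mp (h1 i) (x : A) hx ?_)
    have h2 := Submodule.mem_map_of_mem (f := (veronese 𝒜 n).val.toLinearMap) hx'
    simp only [Submodule.map_iSup] at h2
    exact iSup₂_mono (fun j _ => Submodule.map_comap_le _ _) h2
  · rw [eq_top_iff]
    rintro ⟨a, ha⟩ -
    have h1 : ∀ i : ℕ, (DirectSum.decompose 𝒜 a i : A) ∈ veronese 𝒜 n := by
      intro i
      by_cases hi : n ∣ i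
      · obtain ⟨c, rfl⟩ := hi
        exact mem_veronese_of_mem 𝒜 n c (mul_comm n c ▸ SetLike.coe_mem _)
      · rw [ha i hi]; exact zero_mem _
    have h2 : (⟨a, ha⟩ : veronese 𝒜 n) =
        ∑ i ∈ (DirectSum.decompose 𝒜 a).support, ⟨DirectSum.decompose 𝒜 a i, h1 i⟩ := by
      apply Subtype.ext
      rw [AddSubmonoidClass.coe_finsetSum]
      exact (DirectSum.sum_support_decompose 𝒜 a).symm
    rw [h2]
    refine Submodule.sum_mem _ fun i _ => ?_
    by_cases hi : n ∣ i
    · obtain ⟨c, rfl⟩ := hi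
      refine Submodule.mem_iSup_of_mem c ?_
      change (DirectSum.decompose 𝒜 a (n * c) : A) ∈ 𝒜 (c * n)
      exact mul_comm n c ▸ SetLike.coe_mem _
    · have h3 : (⟨DirectSum.decompose 𝒜 a i, h1 i⟩ : veronese 𝒜 n) = 0 :=
        Subtype.ext (ha i hi)
      rw [h3]
      exact zero_mem _

/-- For `n > 0` the Veronese subalgebra is a graded algebra. -/
noncomputable instance veroneseGradedAlgebra {k A : Type*} [Field k] [Ring A] [Algebra k A]
    (𝒜 : ℕ → Submodule k A) [GradedAlgebra 𝒜] (n : ℕ) [NeZero n] :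
    GradedAlgebra (veronesePiece 𝒜 n) where
  one_mem := by
    change (1 : A) ∈ 𝒜 (0 * n)
    rw [zero_mul]
    exact SetLike.one_mem_graded 𝒜
  mul_mem := by
    intro i j a b ha hb
    change (a : A) * (b : A) ∈ 𝒜 ((i + j) * n)
    rw [add_mul]
    exact SetLike.mul_mem_graded ha hb
  toDecomposition := (veronesePiece_isInternal 𝒜 n).chooseDecomposition

/-! Write B for the Veronese subalgebra. For a connected graded algebra, coherence amounts to two
conditions (`IsConnectedGraded.isCoherentGradedAlgebra_iff`): kernels of graded maps from finite
free modules to the algebra are finitely generated, and so is the augmentation ideal. When the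
algebra is generated in degree one, the second condition says that the degree-one component is
finite dimensional. Once `A₁` is finite dimensional, A is a finitely generated right B-module,
because `A_i = A_{i mod n} A_{n⌊i/n⌋}`.

From A to B: projecting onto degrees divisible by n is a B-bimodule retraction of A onto B. It
carries the A-syzygies of a family in B onto its B-syzygies, so finite generation descends
(`fg_of_veroneseRetraction`).

From B to A: A-syzygies of a family `a_s` come from B-syzygies of the products `a_s w_j`, where the
`w_j` generate A over B (`fg_ker_rightComb_of_subSyzygies`). These split by the residue u of the
degree modulo n. For a fixed u, each member is a combination, with homogeneous coefficients in B, of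
a spanning family v of `A_u`, so its B-syzygies are computed by a matrix over B, provided that the
B-syzygies of v are finitely generated. By the retraction it suffices that the A-syzygies of v are.

That is where the finite presentation enters (`IsConnectedGraded.exists_spanning_fg_ker`). For u = 1
and v a basis, the syzygies are generated by the Fox derivatives of the defining relations;
induction on u uses `A_{u+1} = A_u A_1`.

It remains to deduce that `A₁` is finite dimensional from the same property of `A_n`
(`IsConnectedGraded.piece_one_fg_of_piece_fg`). The relations involve only a finite-dimensional
subspace W of `A₁`, so A maps onto a polynomial ring with one variable for each basis vector of
`A₁/W`; the n-th powers of these variables are independent, which bounds their number by the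
dimension of `A_n`. -/

open MulOpposite

/-! ### Right-linear combinations and kernels of maps from free modules -/

section RightModules

/-- The right `R`-linear map `R^ι → M`, `y ↦ ∑ cᵢ yᵢ`. -/
def rightComb (R : Type*) {M ι : Type*} [Ring R] [AddCommGroup M] [Module Rᵐᵒᵖ M] [Fintype ι]
    (c : ι → M) : (ι → R) →ₗ[Rᵐᵒᵖ] M where
  toFun y := ∑ i, op (y i) • c i
  map_add' x y := by simp [add_smul, Finset.sum_add_distrib]
  map_smul' r x := by
    simp only [RingHom.id_apply, Finset.smul_sum]
    refine Finset.sum_congr rfl fun i _ => ?_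
    rw [smul_smul]
    rfl

variable {R M N ι κ : Type*} [Ring R] [AddCommGroup M] [Module Rᵐᵒᵖ M]
  [AddCommGroup N] [Module Rᵐᵒᵖ N] [Fintype ι] [Fintype κ]

theorem rightComb_apply (c : ι → M) (y : ι → R) : rightComb R c y = ∑ i, op (y i) • c i := rfl

theorem rightComb_self_apply (c : ι → R) (y : ι → R) : rightComb R c y = ∑ i, c i * y i := rfl

theorem rightComb_single [DecidableEq ι] (c : ι → M) (i : ι) (r : R) :
    rightComb R c (Pi.single i r) = op r • c i := by
  rw [rightComb_apply, Finset.sum_eq_single i]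
  · simp
  · intro j _ hj
    simp [Pi.single_eq_of_ne hj]
  · simp

theorem map_rightComb (f : M →ₗ[Rᵐᵒᵖ] N) (c : ι → M) (y : ι → R) :
    f (rightComb R c y) = rightComb R (fun i => f (c i)) y := by
  simp [rightComb_apply, map_sum]

theorem rightComb_pi_apply {κ : Type*} (c : ι → κ → R) (y : ι → R) (l : κ) :
    rightComb R c y l = rightComb R (fun i => c i l) y := by
  simp [rightComb_apply, Finset.sum_apply]

theorem eq_rightComb_single [DecidableEq ι] (y : ι → R) :
    y = rightComb R (fun i => (Pi.single i 1 : ι → R)) y := by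
  funext j
  rw [rightComb_pi_apply, rightComb_self_apply, Finset.sum_eq_single j]
  · simp
  · intro i _ hi
    simp [Pi.single_eq_of_ne hi.symm]
  · simp

theorem linearMap_eq_rightComb [DecidableEq ι] (f : (ι → R) →ₗ[Rᵐᵒᵖ] M) :
    f = rightComb R (fun i => f (Pi.single i 1)) := by
  refine LinearMap.ext fun y => ?_
  exact (congrArg f (eq_rightComb_single y)).trans (map_rightComb f _ y)

theorem range_rightComb (c : ι → M) :
    LinearMap.range (rightComb R c) = Submodule.span Rᵐᵒᵖ (Set.range c) := by
  classical
  apply le_antisymm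
  · rintro _ ⟨y, rfl⟩
    exact Submodule.sum_mem _ fun i _ =>
      Submodule.smul_mem _ _ (Submodule.subset_span ⟨i, rfl⟩)
  · rw [Submodule.span_le]
    rintro _ ⟨i, rfl⟩
    exact ⟨Pi.single i 1, by rw [rightComb_single]; simp⟩

instance finite_pi_mulOpposite {ι : Type*} [Finite ι] : Module.Finite Rᵐᵒᵖ (ι → R) := by
  classical
  cases nonempty_fintype ι
  refine ⟨?_⟩
  have h : LinearMap.range (rightComb R (fun i => (Pi.single i 1 : ι → R))) = ⊤ :=
    LinearMap.range_eq_top.mpr fun y => ⟨y, (eq_rightComb_single y).symm⟩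
  rw [← h, range_rightComb]
  exact Submodule.fg_span (Set.finite_range _)

theorem fg_iff_exists_rightComb {K : Submodule Rᵐᵒᵖ M} :
    K.FG ↔ ∃ (r : ℕ) (c : Fin r → M), LinearMap.range (rightComb R c) = K := by
  rw [Submodule.fg_iff_exists_fin_generating_family]
  simp only [range_rightComb]

/-- Kernels of maps from free modules do not depend on the indexing set. -/
theorem fg_ker_rightComb_equiv (e : ι ≃ κ) (c : κ → M)
    (h : (LinearMap.ker (rightComb R (c ∘ e))).FG) : (LinearMap.ker (rightComb R c)).FG := by
  have h1 : LinearMap.ker (rightComb R c) =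
      (LinearMap.ker (rightComb R (c ∘ e))).map
        (LinearEquiv.funCongrLeft Rᵐᵒᵖ R e.symm).toLinearMap := by
    have h2 : ∀ y : κ → R, rightComb R (c ∘ e) (y ∘ e) = rightComb R c y := fun y =>
      Equiv.sum_comp e fun i => op (y i) • c i
    ext y
    constructor
    · intro hy
      refine ⟨y ∘ e, ?_, ?_⟩
      · exact (h2 y).trans hy
      · funext j
        change y (e (e.symm j)) = y j
        simp
    · rintro ⟨z, hz, rfl⟩
      rw [LinearMap.mem_ker, ← h2]
      have h3 : (LinearEquiv.funCongrLeft Rᵐᵒᵖ R e.symm).toLinearMap z ∘ e = z := by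
        funext j
        change z (e.symm (e j)) = z j
        simp
      rw [h3]
      exact hz
  rw [h1]
  exact h.map _

end RightModules

/-! ### Integer degrees, homogeneous generators, and kernels of matrices -/

section IntegerDegrees

variable {k A : Type*} [Field k] [Ring A] [Algebra k A]
  (𝒜 : ℕ → Submodule k A)

/-- Kernels of degree-preserving maps `⨁ A(-d_s) → A` are finitely generated. -/
def HasFGKernels : Prop :=
  ∀ (r : ℕ) (d : Fin r → ℤ) (a : Fin r → A), (∀ s, a s ∈ intPiece 𝒜 (d s)) →
    (LinearMap.ker (rightComb A a)).FG

theorem HasFGKernels.fg_ker {𝒜 : ℕ → Submodule k A} (h : HasFGKernels 𝒜)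
    {ι : Type*} [Fintype ι] (d : ι → ℤ) (a : ι → A) (ha : ∀ s, a s ∈ intPiece 𝒜 (d s)) : (LinearMap.ker (rightComb A a)).FG :=
  fg_ker_rightComb_equiv (Fintype.equivFin ι).symm a
    (h _ (d ∘ (Fintype.equivFin ι).symm) _ fun _ => ha _)

theorem mul_mem_intPiece [GradedAlgebra 𝒜] {i j : ℤ} {a b : A} (ha : a ∈ intPiece 𝒜 i)
    (hb : b ∈ intPiece 𝒜 j) : a * b ∈ intPiece 𝒜 (i + j) := by
  cases i with
  | negSucc i =>
    have : a = 0 := ha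
    rw [this, zero_mul]
    exact zero_mem _
  | ofNat i =>
    cases j with
    | negSucc j =>
      have : b = 0 := hb
      rw [this, mul_zero]
      exact zero_mem _
    | ofNat j => exact SetLike.mul_mem_graded (A := 𝒜) ha hb

/-- The projection onto the component of integer degree `i`. -/
def intProj [GradedAlgebra 𝒜] : ℤ → A →+ A
  | Int.ofNat i => GradedRing.proj 𝒜 i
  | Int.negSucc _ => 0

variable [GradedAlgebra 𝒜]

theorem intProj_mem (i : ℤ) (a : A) : intProj 𝒜 i a ∈ intPiece 𝒜 i := by
  cases i with
  | ofNat i => exact SetLike.coe_mem (DirectSum.decompose 𝒜 a i)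
  | negSucc i => exact zero_mem _

theorem intProj_of_mem {i : ℤ} {a : A} (ha : a ∈ intPiece 𝒜 i) : intProj 𝒜 i a = a := by
  cases i with
  | ofNat i => exact DirectSum.decompose_of_mem_same 𝒜 ha
  | negSucc i => exact (show a = 0 from ha).symm

theorem intProj_of_mem_ne {i j : ℤ} {a : A} (ha : a ∈ intPiece 𝒜 i) (hij : i ≠ j) :
    intProj 𝒜 j a = 0 := by
  cases i with
  | ofNat i =>
    cases j with
    | ofNat j => exact DirectSum.decompose_of_mem_ne 𝒜 ha fun h => hij (congrArg _ h)
    | negSucc j => rfl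
  | negSucc i => rw [show a = 0 from ha, map_zero]

theorem exists_finset_sum_intProj (a : A) :
    ∃ F : Finset ℤ, ∀ J, F ⊆ J → ∑ i ∈ J, intProj 𝒜 i a = a := by
  classical
  refine ⟨(DirectSum.decompose 𝒜 a).support.map ⟨Int.ofNat, Int.ofNat_injective⟩, fun J hJ => ?_⟩
  rw [← Finset.sum_subset hJ]
  · rw [Finset.sum_map]
    exact DirectSum.sum_support_decompose 𝒜 a
  · intro i _ hi
    cases i with
    | ofNat i =>
      by_contra h
      refine hi (Finset.mem_map.mpr ⟨i, ?_, rfl⟩)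
      rw [DFinsupp.mem_support_iff]
      intro h0
      apply h
      change ((DirectSum.decompose 𝒜 a i : 𝒜 i) : A) = 0
      rw [h0]
      rfl
    | negSucc i => rfl

theorem intProj_mul {d : ℤ} {a : A} (ha : a ∈ intPiece 𝒜 d) (i : ℤ) (x : A) :
    intProj 𝒜 (d + i) (a * x) = a * intProj 𝒜 i x := by
  classical
  obtain ⟨F, hF⟩ := exists_finset_sum_intProj 𝒜 x
  rw [← hF (insert i F) (Finset.subset_insert _ _), Finset.mul_sum, map_sum, map_sum,
    Finset.mul_sum]
  refine Finset.sum_congr rfl fun j _ => ?_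
  have h := mul_mem_intPiece 𝒜 ha (intProj_mem 𝒜 j x)
  by_cases hj : j = i
  · subst hj
    rw [intProj_of_mem 𝒜 h, intProj_of_mem 𝒜 (intProj_mem 𝒜 j x)]
  · rw [intProj_of_mem_ne 𝒜 h (by omega), intProj_of_mem_ne 𝒜 (intProj_mem 𝒜 j x) hj, mul_zero]

/-- The projection of `⨁ A(d_s)` onto its component of degree `i`. -/
def freeProj {ι : Type*} (d : ι → ℤ) (i : ℤ) : (ι → A) →+ (ι → A) where
  toFun x s := intProj 𝒜 (i + d s) (x s)
  map_zero' := by funext s; exact map_zero _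
  map_add' x y := by funext s; exact map_add _ _ _

theorem freeProj_apply {ι : Type*} (d : ι → ℤ) (i : ℤ) (x : ι → A) (s : ι) :
    freeProj 𝒜 d i x s = intProj 𝒜 (i + d s) (x s) := rfl

theorem exists_finset_sum_freeProj {ι : Type*} [Finite ι] (d : ι → ℤ) (x : ι → A) :
    ∃ F : Finset ℤ, ∀ J, F ⊆ J → ∑ i ∈ J, freeProj 𝒜 d i x = x := by
  classical
  cases nonempty_fintype ι
  choose F hF using fun s => exists_finset_sum_intProj 𝒜 (x s)
  refine ⟨Finset.univ.biUnion fun s => (F s).image (· - d s), fun J hJ => ?_⟩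
  funext s
  rw [Finset.sum_apply, ← hF s (J.image (· + d s)), Finset.sum_image (by intro a _ b _; simp)]
  · rfl
  · intro i hi
    refine Finset.mem_image.mpr ⟨i - d s, hJ ?_, by simp⟩
    exact Finset.mem_biUnion.mpr ⟨s, Finset.mem_univ s, Finset.mem_image_of_mem _ hi⟩

/-- A finitely generated homogeneous submodule of a free module is generated by finitely many
homogeneous elements. -/
theorem exists_homogeneous_generators {ι : Type*} [Finite ι] (d : ι → ℤ)
    {K : Submodule Aᵐᵒᵖ (ι → A)} (hK : K.FG) (hd : ∀ i, ∀ x ∈ K, freeProj 𝒜 d i x ∈ K) :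
    ∃ (r : ℕ) (e : Fin r → ℤ) (g : Fin r → ι → A),
      (∀ t s, g t s ∈ intPiece 𝒜 (e t + d s)) ∧ LinearMap.range (rightComb A g) = K := by
  classical
  obtain ⟨S, rfl⟩ := hK
  choose F hF using exists_finset_sum_freeProj 𝒜 d
  -- The new generators are the homogeneous components of the old ones; T records which component of
  -- which generator.
  let T : Finset (ℤ × (ι → A)) := S.biUnion fun x => (F x).image fun i => (i, x)
  refine ⟨T.card, fun t => (T.equivFin.symm t).1.1,
    fun t => freeProj 𝒜 d (T.equivFin.symm t).1.1 (T.equivFin.symm t).1.2,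
    fun t s => intProj_mem 𝒜 _ _, ?_⟩
  rw [range_rightComb]
  apply le_antisymm
  · rw [Submodule.span_le]
    rintro _ ⟨t, rfl⟩
    refine hd _ _ ?_
    obtain ⟨x, hx, hx'⟩ := Finset.mem_biUnion.mp (T.equivFin.symm t).2
    obtain ⟨i, _, hi⟩ := Finset.mem_image.mp hx'
    rw [← hi]
    exact Submodule.subset_span hx
  · rw [Submodule.span_le]
    intro x hx
    rw [SetLike.mem_coe, ← hF x (F x) subset_rfl]
    refine Submodule.sum_mem _ fun i hi => Submodule.subset_span ?_
    have hT : (i, x) ∈ T := Finset.mem_biUnion.mpr ⟨x, hx, Finset.mem_image_of_mem _ hi⟩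
    exact ⟨T.equivFin ⟨(i, x), hT⟩, by simp⟩

/-- The kernel of a map given by homogeneous elements is homogeneous. -/
theorem freeProj_mem_ker_rightComb {ι κ : Type*} [Fintype ι] {d : ι → ℤ} {c : ι → κ → A}
    (hc : ∀ q l, c q l ∈ intPiece 𝒜 (d q)) (i : ℤ) {x : ι → A}
    (hx : x ∈ LinearMap.ker (rightComb A c)) :
    freeProj 𝒜 (fun q => -d q) i x ∈ LinearMap.ker (rightComb A c) := by
  rw [LinearMap.mem_ker] at hx ⊢
  funext l
  have h := congrFun hx l
  rw [rightComb_pi_apply, rightComb_self_apply] at h ⊢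
  have h1 := congrArg (intProj 𝒜 i) h
  rw [map_sum] at h1
  refine Eq.trans (Finset.sum_congr rfl fun q _ => ?_) (h1.trans (map_zero _))
  rw [freeProj_apply, ← intProj_mul 𝒜 (hc q l), show d q + (i + -d q) = i by omega]

variable {𝒜}

/-- Kernels of degree-preserving maps `⨁ A(-d_s) → A^m` are finitely generated. -/
theorem HasFGKernels.fg_ker_matrix (h : HasFGKernels 𝒜) (m : ℕ) :
    ∀ {ι : Type} [Fintype ι] (d : ι → ℤ) (c : ι → Fin m → A),
      (∀ q l, c q l ∈ intPiece 𝒜 (d q)) → (LinearMap.ker (rightComb A c)).FG := by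
  induction m with
  | zero =>
    intro ι _ d c _
    have : LinearMap.ker (rightComb A c) = ⊤ := by
      rw [LinearMap.ker_eq_top]
      exact Subsingleton.elim _ _
    rw [this]
    exact Module.Finite.fg_top
  | succ m ih =>
    -- Solve one row at a time: g generates the kernel of row 0, and substituting y = g z turns the
    -- other rows into a homogeneous system with one row fewer.
    intro ι _ d c hc
    obtain ⟨r, e, g, hg, hK⟩ := exists_homogeneous_generators 𝒜 (fun q => -d q)
      (h.fg_ker d (fun q => c q 0) fun q => hc q 0) (fun i x hx => by
        have h1 := freeProj_mem_ker_rightComb 𝒜 (κ := Unit) (c := fun q _ => c q 0)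
          (fun q _ => hc q 0) i (x := x)
        have h2 : ∀ y : ι → A, y ∈ LinearMap.ker (rightComb A fun q (_ : Unit) => c q 0) ↔
            y ∈ LinearMap.ker (rightComb A fun q => c q 0) := by
          intro y
          rw [LinearMap.mem_ker, LinearMap.mem_ker, funext_iff]
          simp only [rightComb_pi_apply, Pi.zero_apply, forall_const]
        exact (h2 _).mp (h1 ((h2 _).mpr hx)))
    have hK0 : ∀ z, rightComb A (fun q => c q 0) (rightComb A g z) = 0 := fun z =>
      (hK.le ⟨z, rfl⟩ : rightComb A g z ∈ LinearMap.ker (rightComb A fun q => c q 0))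
    have h1 := ih e (fun t l => rightComb A (fun q => c q l.succ) (g t)) (by
      intro t l
      rw [rightComb_self_apply]
      refine Submodule.sum_mem _ fun q _ => ?_
      have := mul_mem_intPiece 𝒜 (hc q l.succ) (hg t q)
      convert this using 2
      omega)
    have h2 : LinearMap.ker (rightComb A c) =
        (LinearMap.ker (rightComb A fun t (l : Fin m) =>
          rightComb A (fun q => c q l.succ) (g t))).map (rightComb A g) := by
      have h3 : ∀ z, rightComb A c (rightComb A g z) = 0 ↔
          rightComb A (fun t (l : Fin m) => rightComb A (fun q => c q l.succ) (g t)) z = 0 := by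
        intro z
        simp only [funext_iff, Fin.forall_fin_succ, Pi.zero_apply]
        rw [rightComb_pi_apply c, hK0]
        simp only [true_and]
        refine forall_congr' fun l => ?_
        rw [rightComb_pi_apply c, map_rightComb, rightComb_pi_apply]
      ext y
      constructor
      · intro hy
        have hy0 : y ∈ LinearMap.range (rightComb A g) := by
          rw [hK, LinearMap.mem_ker, ← rightComb_pi_apply c y 0, LinearMap.mem_ker.mp hy]
          rfl
        obtain ⟨z, rfl⟩ := hy0
        exact ⟨z, (h3 z).mp hy, rfl⟩
      · rintro ⟨z, hz, rfl⟩
        exact (h3 z).mpr hz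
    rw [h2]
    exact h1.map _

end IntegerDegrees

/-! ### Coherence of a connected graded algebra in terms of syzygies -/

section CoherenceCriterion

variable {k A : Type*} [Field k] [Ring A] [Algebra k A]
  {𝒜 : ℕ → Submodule k A}

theorem mem_freePiece {r : ℕ} {d : Fin r → ℤ} {i : ℤ} {x : Fin r → A} :
    x ∈ freePiece 𝒜 d i ↔ ∀ s, x s ∈ intPiece 𝒜 (i + d s) := by
  simp only [freePiece, AddSubgroup.mem_pi, Set.mem_univ, true_imp_iff]
  rfl

theorem IsFinitelyGeneratedGraded.finite {M : Type*} [AddCommGroup M] [Module Aᵐᵒᵖ M]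
    {ℳ : ℤ → AddSubgroup M} (h : IsFinitelyGeneratedGraded 𝒜 ℳ) : Module.Finite Aᵐᵒᵖ M := by
  obtain ⟨r, d, f, -, hf⟩ := h
  exact Module.Finite.of_surjective f hf

variable [GradedAlgebra 𝒜]

/-- Reduces graded finite generation to ordinary finite generation. A homogeneous generator of
degree e is hit from the summand `A(-e)`, hence the sign of the witness. -/
theorem isFinitelyGeneratedGraded_of_fg {r : ℕ} {d : Fin r → ℤ} {K : Submodule Aᵐᵒᵖ (Fin r → A)}
    (hK : K.FG) (hd : ∀ i, ∀ x ∈ K, freeProj 𝒜 d i x ∈ K) :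
    IsFinitelyGeneratedGraded 𝒜 (inducedPiece (freePiece 𝒜 d) K) := by
  obtain ⟨r', e, g, hg, hgK⟩ := exists_homogeneous_generators 𝒜 d hK hd
  refine ⟨r', fun t => -e t, (rightComb A g).codRestrict K fun z => hgK ▸ ⟨z, rfl⟩, ?_, ?_⟩
  · intro i z hz
    rw [mem_freePiece] at hz
    change rightComb A g z ∈ freePiece 𝒜 d i
    rw [mem_freePiece]
    intro s
    rw [rightComb_pi_apply, rightComb_self_apply]
    refine Submodule.sum_mem _ fun t _ => ?_
    have := mul_mem_intPiece 𝒜 (hg t s) (hz t)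
    convert this using 2
    omega
  · rintro ⟨x, hx⟩
    rw [← hgK] at hx
    obtain ⟨z, rfl⟩ := hx
    exact ⟨z, rfl⟩

/-- The projection to degree 0 is a ring homomorphism, so its kernel is a two-sided ideal; this
makes the right ideal `A₊` stable under left multiplication as well. -/
theorem mem_augmentationIdeal_iff {a : A} :
    a ∈ augmentationIdeal 𝒜 ↔ GradedRing.projZeroRingHom 𝒜 a = 0 := by
  classical
  constructor
  · intro ha
    induction ha using Submodule.span_induction with
    | mem x hx =>
      obtain ⟨i, hi, hx⟩ := hx
      exact DirectSum.decompose_of_mem_ne 𝒜 hx hi.ne'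
    | zero => exact map_zero _
    | add x y _ _ hx hy => rw [map_add, hx, hy, add_zero]
    | smul r x _ hx => rw [← op_unop r, op_smul_eq_mul, map_mul, hx, zero_mul]
  · intro ha
    rw [← DirectSum.sum_support_decompose 𝒜 a]
    refine Submodule.sum_mem _ fun i _ => ?_
    rcases Nat.eq_zero_or_pos i with rfl | hi
    · rw [show (DirectSum.decompose 𝒜 a 0 : A) = 0 from ha]
      exact zero_mem _
    · exact Submodule.subset_span ⟨i, hi, SetLike.coe_mem _⟩

theorem mul_mem_augmentationIdeal (a : A) {x : A} (hx : x ∈ augmentationIdeal 𝒜) :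
    a * x ∈ augmentationIdeal 𝒜 := by
  rw [mem_augmentationIdeal_iff] at hx ⊢
  rw [map_mul, hx, mul_zero]

theorem IsConnectedGraded.exists_algebraMap_eq (hconn : IsConnectedGraded 𝒜) (a : A) :
    ∃ c : k, algebraMap k A c = GradedRing.projZeroRingHom 𝒜 a := by
  have h : GradedRing.projZeroRingHom 𝒜 a ∈ 𝒜 0 := SetLike.coe_mem (DirectSum.decompose 𝒜 a 0)
  rw [hconn.2] at h
  exact h

theorem projZeroRingHom_algebraMap (c : k) :
    GradedRing.projZeroRingHom 𝒜 (algebraMap k A c) = algebraMap k A c :=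
  DirectSum.decompose_of_mem_same 𝒜 (SetLike.algebraMap_mem_graded 𝒜 c)

/-- The degree-0 part of a representative of a nonzero class is an invertible scalar, so every
nonzero submodule contains the class of 1 and is everything. -/
theorem IsConnectedGraded.isNoetherian_quotient (hconn : IsConnectedGraded 𝒜) :
    IsNoetherian Aᵐᵒᵖ (A ⧸ augmentationIdeal 𝒜) := by
  refine ⟨fun N => ?_⟩
  by_cases h : ∀ x ∈ N, x = 0
  · rw [(Submodule.eq_bot_iff N).mpr h]
    exact Submodule.fg_bot
  · push Not at h
    obtain ⟨x, hx, hx0⟩ := h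
    obtain ⟨a, rfl⟩ := Submodule.Quotient.mk_surjective _ x
    obtain ⟨c, hc⟩ := hconn.exists_algebraMap_eq a
    have hc0 : c ≠ 0 := by
      rintro rfl
      refine hx0 ((Submodule.Quotient.mk_eq_zero _).mpr (mem_augmentationIdeal_iff.mpr ?_))
      rw [← hc, map_zero]
    have h1 : (Submodule.Quotient.mk 1 : A ⧸ augmentationIdeal 𝒜) ∈ N := by
      have h2 := N.smul_mem (op (algebraMap k A c⁻¹)) hx
      rw [← Submodule.Quotient.mk_smul] at h2
      convert h2 using 1
      rw [Submodule.Quotient.eq, mem_augmentationIdeal_iff, map_sub, op_smul_eq_mul, map_mul, ← hc,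
        projZeroRingHom_algebraMap, ← map_mul, mul_inv_cancel₀ hc0, map_one, map_one, sub_self]
    have h3 : N = Submodule.span Aᵐᵒᵖ {Submodule.Quotient.mk 1} := by
      apply le_antisymm
      · intro y _
        obtain ⟨b, rfl⟩ := Submodule.Quotient.mk_surjective _ y
        refine Submodule.mem_span_singleton.mpr ⟨op b, ?_⟩
        rw [← Submodule.Quotient.mk_smul, op_smul_eq_mul, one_mul]
      · rw [Submodule.span_le, Set.singleton_subset_iff]
        exact h1
    rw [h3]
    exact Submodule.fg_span_singleton _

/-- A submodule of a finite free module that contains all vectors with entries in `A₊` is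
finitely generated. -/
theorem IsConnectedGraded.fg_of_augmentationIdeal_le (hconn : IsConnectedGraded 𝒜)
    (haug : (augmentationIdeal 𝒜).FG) {ι : Type*} [Finite ι] {P : Submodule Aᵐᵒᵖ (ι → A)}
    (hP : ∀ x : ι → A, (∀ s, x s ∈ augmentationIdeal 𝒜) → x ∈ P) : P.FG := by
  have := hconn.isNoetherian_quotient
  refine Submodule.fg_of_fg_map_of_fg_inf_ker
    ((augmentationIdeal 𝒜).mkQ.compLeft ι) (IsNoetherian.noetherian _) ?_
  have h : P ⊓ LinearMap.ker ((augmentationIdeal 𝒜).mkQ.compLeft ι) =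
      Submodule.pi Set.univ fun _ => augmentationIdeal 𝒜 := by
    have h1 : ∀ x : ι → A, x ∈ LinearMap.ker ((augmentationIdeal 𝒜).mkQ.compLeft ι) ↔
        ∀ s, x s ∈ augmentationIdeal 𝒜 := by
      intro x
      rw [LinearMap.mem_ker, funext_iff]
      exact forall_congr' fun s => Submodule.Quotient.mk_eq_zero _
    ext x
    rw [Submodule.mem_inf, h1, Submodule.mem_pi]
    exact ⟨fun h s _ => h.2 s, fun h => ⟨hP x fun s => h s trivial, fun s => h s trivial⟩⟩
  rw [h]
  exact Submodule.fg_pi fun _ => haug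

/-- For submodules `N' ≤ N` with `N A₊ ⊆ N'`, if `N` is finitely generated then so is `N'`. -/
theorem IsConnectedGraded.fg_of_smul_augmentationIdeal_le (hconn : IsConnectedGraded 𝒜)
    (haug : (augmentationIdeal 𝒜).FG) {M : Type*} [AddCommGroup M] [Module Aᵐᵒᵖ M]
    {N N' : Submodule Aᵐᵒᵖ M} (hN : N.FG) (hle : N' ≤ N)
    (hmul : ∀ x ∈ N, ∀ a ∈ augmentationIdeal 𝒜, op a • x ∈ N') : N'.FG := by
  obtain ⟨r, c, rfl⟩ := fg_iff_exists_rightComb.mp hN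
  -- Pull back to a free module covering N: the preimage of N' contains all vectors with entries in
  -- `A₊`, so the previous finiteness result applies.
  have h : N' = (N'.comap (rightComb A c)).map (rightComb A c) := by
    rw [Submodule.map_comap_eq, inf_eq_right.mpr hle]
  rw [h]
  refine Submodule.FG.map _ (hconn.fg_of_augmentationIdeal_le haug fun x hx => ?_)
  rw [Submodule.mem_comap, rightComb_apply]
  refine Submodule.sum_mem _ fun i _ => hmul _ ?_ _ (hx i)
  rw [range_rightComb]
  exact Submodule.subset_span ⟨i, rfl⟩

/-- A graded map is determined by the images of the standard basis vectors, which are homogeneous: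
the vector s has degree `-d s`, so its image lies in `A_{j - d s}`. -/
theorem shiftPiece_isCoherentGraded (h : HasFGKernels 𝒜) (j : ℤ) :
    IsCoherentGraded 𝒜 (shiftPiece 𝒜 j) := by
  constructor
  · refine ⟨1, fun _ => j, LinearMap.proj 0, fun i x hx => ?_, fun a => ⟨fun _ => a, rfl⟩⟩
    exact mem_freePiece.mp hx 0
  · intro r d f hf
    have hc : ∀ s, f (Pi.single s 1) ∈ intPiece 𝒜 (j - d s) := by
      intro s
      have h1 := hf (-d s) (Pi.single s 1) (by
        rw [mem_freePiece]
        intro t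
        rcases eq_or_ne t s with rfl | hts
        · rw [Pi.single_eq_same, neg_add_cancel]
          exact SetLike.one_mem_graded 𝒜
        · rw [Pi.single_eq_of_ne hts]
          exact zero_mem _)
      convert (show f (Pi.single s 1) ∈ intPiece 𝒜 (-d s + j) from h1) using 2
      omega
    refine isFinitelyGeneratedGraded_of_fg ?_ ?_
    · rw [linearMap_eq_rightComb f]
      exact h r _ _ hc
    · intro i x hx
      rw [linearMap_eq_rightComb f, LinearMap.mem_ker, rightComb_self_apply] at hx ⊢
      have h1 := congrArg (intProj 𝒜 (i + j)) hx
      rw [map_sum] at h1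
      refine Eq.trans (Finset.sum_congr rfl fun q _ => ?_) (h1.trans (map_zero _))
      rw [freeProj_apply, ← intProj_mul 𝒜 (hc q), show j - d q + (i + d q) = i + j by omega]

/-- Since `A₊` annihilates the simple module, every kernel contains all vectors with entries in
`A₊`. The kernel is homogeneous because the target lives in the single degree j. -/
theorem simplePiece_isCoherentGraded (hconn : IsConnectedGraded 𝒜)
    (haug : (augmentationIdeal 𝒜).FG) (j : ℤ) : IsCoherentGraded 𝒜 (simplePiece 𝒜 j) := by
  constructor
  · refine ⟨1, fun _ => -j, (augmentationIdeal 𝒜).mkQ ∘ₗ LinearMap.proj 0, fun i x hx => ?_,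
      fun y => ?_⟩
    · have h := mem_freePiece.mp hx 0
      unfold simplePiece
      split_ifs with hij
      · trivial
      · refine (Submodule.Quotient.mk_eq_zero _).mpr ?_
        change x 0 ∈ augmentationIdeal 𝒜
        obtain ⟨m, hm⟩ : ∃ m, m = i + -j := ⟨_, rfl⟩
        rw [← hm] at h
        cases m with
        | negSucc m =>
          rw [show x 0 = 0 from h]
          exact zero_mem _
        | ofNat m =>
          refine Submodule.subset_span ⟨m, Nat.pos_of_ne_zero ?_, h⟩
          rintro rfl
          apply hij
          simp only [Int.ofNat_eq_natCast] at hm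
          omega
    · obtain ⟨a, rfl⟩ := Submodule.Quotient.mk_surjective _ y
      exact ⟨fun _ => a, rfl⟩
  · intro r d f hf
    refine isFinitelyGeneratedGraded_of_fg ?_ ?_
    · refine hconn.fg_of_augmentationIdeal_le haug fun x hx => ?_
      rw [linearMap_eq_rightComb f, LinearMap.mem_ker, rightComb_apply]
      refine Finset.sum_eq_zero fun s _ => ?_
      obtain ⟨a, ha⟩ := Submodule.Quotient.mk_surjective _ (f (Pi.single s 1))
      rw [← ha, ← Submodule.Quotient.mk_smul, op_smul_eq_mul, Submodule.Quotient.mk_eq_zero]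
      exact mul_mem_augmentationIdeal a (hx s)
    · intro i x hx
      have h0 : ∀ i, i ≠ j → f (freeProj 𝒜 d i x) = 0 := by
        intro i hij
        have h1 := hf i (freeProj 𝒜 d i x) (mem_freePiece.mpr fun s => intProj_mem 𝒜 _ _)
        unfold simplePiece at h1
        rw [if_neg hij] at h1
        exact h1
      by_cases hij : i = j
      · subst hij
        obtain ⟨F, hF⟩ := exists_finset_sum_freeProj 𝒜 d x
        -- Only the component of degree j can have nonzero image, so its image equals f x = 0;
        -- inserting i ensures that this component appears in the sum.
        have h2 := congrArg f (hF (insert i F) (Finset.subset_insert _ _))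
        rw [map_sum, LinearMap.mem_ker.mp hx, Finset.sum_eq_single i (fun j _ hj => h0 j hj)
          (fun h => absurd (Finset.mem_insert_self i F) h)] at h2
        exact h2
      · exact h0 i hij

/-- A connected graded algebra is coherent if and only if kernels of degree-preserving maps
`⨁ A(-d_s) → A` are finitely generated and `A₊` is finitely generated. -/
theorem IsConnectedGraded.isCoherentGradedAlgebra_iff (hconn : IsConnectedGraded 𝒜) :
    IsCoherentGradedAlgebra 𝒜 ↔ HasFGKernels 𝒜 ∧ (augmentationIdeal 𝒜).FG := by
  constructor
  · rintro ⟨h1, h2⟩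
    constructor
    · intro r d a ha
      have h := (h1 0).2 r (fun s => -d s) (rightComb A a) (fun i x hx => by
        rw [mem_freePiece] at hx
        rw [rightComb_self_apply]
        refine Submodule.sum_mem _ fun s _ => ?_
        have := mul_mem_intPiece 𝒜 (ha s) (hx s)
        convert this using 2
        omega)
      exact Module.Finite.iff_fg.mp h.finite
    -- The augmentation ideal is the kernel of the graded surjection from A to `S_0`.
    · obtain ⟨-, hker⟩ := h2 0
      have h := hker 1 (fun _ => 0) ((augmentationIdeal 𝒜).mkQ ∘ₗ LinearMap.proj 0) (by
        intro i x hx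
        have h := mem_freePiece.mp hx 0
        unfold simplePiece
        split_ifs with hij
        · trivial
        · refine (Submodule.Quotient.mk_eq_zero _).mpr ?_
          change x 0 ∈ augmentationIdeal 𝒜
          rw [add_zero] at h
          cases i with
          | negSucc m =>
            rw [show x 0 = 0 from h]
            exact zero_mem _
          | ofNat m =>
            refine Submodule.subset_span ⟨m, Nat.pos_of_ne_zero ?_, h⟩
            rintro rfl
            exact hij rfl)
      have h3 : augmentationIdeal 𝒜 = (LinearMap.ker ((augmentationIdeal 𝒜).mkQ ∘ₗ
          (LinearMap.proj 0 : (Fin 1 → A) →ₗ[Aᵐᵒᵖ] A))).map (LinearMap.proj 0) := by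
        ext a
        constructor
        · intro ha
          exact ⟨fun _ => a, (Submodule.Quotient.mk_eq_zero _).mpr ha, rfl⟩
        · rintro ⟨x, hx, rfl⟩
          exact (Submodule.Quotient.mk_eq_zero _).mp hx
      rw [h3]
      exact (Module.Finite.iff_fg.mp h.finite).map _
  · rintro ⟨h1, h2⟩
    exact ⟨fun j => shiftPiece_isCoherentGraded h1 j,
      fun j => simplePiece_isCoherentGraded hconn h2 j⟩

end CoherenceCriterion

/-! ### Components and augmentation ideal of an algebra generated in degree one -/

section GeneratedInDegreeOne

variable {k A : Type*} [Field k] [Ring A] [Algebra k A]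

/-- Scalars commute past the left factor and are absorbed by Y. With X and Y components of A, this
keeps the coefficients homogeneous of a known degree. -/
theorem exists_rightComb_of_mem_mul {ι : Type*} [Fintype ι] {x : ι → A} {X Y : Submodule k A}
    (hx : Submodule.span k (Set.range x) = X) {a : A} (ha : a ∈ X * Y) :
    ∃ β : ι → A, (∀ l, β l ∈ Y) ∧ rightComb A x β = a := by
  classical
  induction ha using Submodule.mul_induction_on' with
  | mem_mul_mem a ha b hb =>
    rw [← hx, Submodule.mem_span_range_iff_exists_fun] at ha
    obtain ⟨c, rfl⟩ := ha
    refine ⟨fun l => c l • b, fun l => Y.smul_mem _ hb, ?_⟩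
    rw [rightComb_self_apply, Finset.sum_mul]
    exact Finset.sum_congr rfl fun l _ => by rw [mul_smul_comm, smul_mul_assoc]
  | add a _ b _ ha hb =>
    obtain ⟨β, hβ, rfl⟩ := ha
    obtain ⟨γ, hγ, rfl⟩ := hb
    exact ⟨β + γ, fun l => Y.add_mem (hβ l) (hγ l), map_add _ _ _⟩

theorem tensorToAlgebra_surjective {𝒜 : ℕ → Submodule k A}
    (hgen : GeneratedInDegreeOne 𝒜) :
    Function.Surjective (tensorToAlgebra 𝒜) := by
  rw [← AlgHom.range_eq_top, eq_top_iff, ← show _ = ⊤ from hgen, Algebra.adjoin_le_iff]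
  intro a ha
  exact ⟨TensorAlgebra.ι k ⟨a, ha⟩, TensorAlgebra.lift_ι_apply _ _⟩

variable {𝒜 : ℕ → Submodule k A} [GradedAlgebra 𝒜]

theorem IsConnectedGraded.piece_zero_eq_one (hconn : IsConnectedGraded 𝒜) : 𝒜 0 = 1 := by
  rw [hconn.2, Submodule.one_eq_range]

theorem IsConnectedGraded.piece_eq_pow (hconn : IsConnectedGraded 𝒜)
    (hgen : GeneratedInDegreeOne 𝒜) (m : ℕ) : 𝒜 m = 𝒜 1 ^ m := by
  classical
  apply le_antisymm
  · have h : ∀ a ∈ Algebra.adjoin k (𝒜 1 : Set A), ∀ m,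
        (DirectSum.decompose 𝒜 a m : A) ∈ 𝒜 1 ^ m := by
      intro a ha
      induction ha using Algebra.adjoin_induction with
      | mem x hx =>
        intro m
        by_cases hm : 1 = m
        · subst hm
          rw [pow_one]
          exact SetLike.coe_mem _
        · rw [DirectSum.decompose_of_mem_ne 𝒜 hx hm]
          exact zero_mem _
      | algebraMap c =>
        intro m
        by_cases hm : 0 = m
        · subst hm
          rw [pow_zero, ← hconn.piece_zero_eq_one]
          exact SetLike.coe_mem _
        · rw [DirectSum.decompose_of_mem_ne 𝒜 (SetLike.algebraMap_mem_graded 𝒜 c) hm]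
          exact zero_mem _
      | add x y _ _ hx hy =>
        intro m
        rw [DirectSum.decompose_add]
        exact Submodule.add_mem _ (hx m) (hy m)
      | mul x y _ _ hx hy =>
        intro m
        rw [DirectSum.decompose_mul, DirectSum.coe_mul_apply]
        refine Submodule.sum_mem _ fun p hp => ?_
        obtain ⟨-, hp⟩ := Finset.mem_filter.mp hp
        rw [← hp, pow_add]
        exact Submodule.mul_mem_mul (hx _) (hy _)
    intro a ha
    have h1 := h a (by rw [hgen]; trivial) m
    rwa [DirectSum.decompose_of_mem_same 𝒜 ha] at h1
  · induction m with
    | zero => rw [pow_zero, hconn.piece_zero_eq_one]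
    | succ m ih =>
      rw [pow_succ, Submodule.mul_le]
      exact fun a ha b hb => SetLike.mul_mem_graded (ih ha) hb

theorem IsConnectedGraded.piece_add (hconn : IsConnectedGraded 𝒜)
    (hgen : GeneratedInDegreeOne 𝒜) (i j : ℕ) : 𝒜 (i + j) = 𝒜 i * 𝒜 j := by
  rw [hconn.piece_eq_pow hgen (i + j), hconn.piece_eq_pow hgen i, hconn.piece_eq_pow hgen j,
    pow_add]

theorem IsConnectedGraded.range_rightComb_eq (hconn : IsConnectedGraded 𝒜)
    (hgen : GeneratedInDegreeOne 𝒜) {ι : Type*} [Fintype ι] {x : ι → A}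
    (hx : Submodule.span k (Set.range x) = 𝒜 1) :
    LinearMap.range (rightComb A x) = augmentationIdeal 𝒜 := by
  apply le_antisymm
  · rw [range_rightComb, augmentationIdeal]
    refine Submodule.span_mono ?_
    rintro _ ⟨l, rfl⟩
    exact ⟨1, one_pos, hx ▸ Submodule.subset_span ⟨l, rfl⟩⟩
  · rw [augmentationIdeal, Submodule.span_le]
    rintro a ⟨i, hi, ha⟩
    obtain ⟨i, rfl⟩ := Nat.exists_eq_add_of_lt hi
    rw [zero_add, add_comm, hconn.piece_add hgen] at ha
    obtain ⟨β, -, hβ⟩ := exists_rightComb_of_mem_mul hx ha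
    exact ⟨β, hβ⟩

theorem IsConnectedGraded.augmentationIdeal_fg (hconn : IsConnectedGraded 𝒜)
    (hgen : GeneratedInDegreeOne 𝒜) (h1 : (𝒜 1).FG) : (augmentationIdeal 𝒜).FG := by
  obtain ⟨r, x, hx⟩ := Submodule.fg_iff_exists_fin_generating_family.mp h1
  exact fg_iff_exists_rightComb.mpr ⟨r, x, hconn.range_rightComb_eq hgen hx⟩

/-- The degree-one parts of generators of `A₊` span `A₁`: if x has no degree-0 part, then the
degree-one part of x r is that of x times the scalar `r_0`. -/
theorem IsConnectedGraded.piece_one_fg (hconn : IsConnectedGraded 𝒜)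
    (haug : (augmentationIdeal 𝒜).FG) : (𝒜 1).FG := by
  classical
  obtain ⟨S, hS⟩ := haug
  refine ⟨S.image (GradedRing.proj 𝒜 1), ?_⟩
  rw [Finset.coe_image]
  apply le_antisymm
  · rw [Submodule.span_le]
    rintro _ ⟨x, -, rfl⟩
    exact SetLike.coe_mem (DirectSum.decompose 𝒜 x 1)
  · have h : ∀ a ∈ augmentationIdeal 𝒜,
        GradedRing.proj 𝒜 1 a ∈ Submodule.span k (GradedRing.proj 𝒜 1 '' (S : Set A)) := by
      intro a ha
      rw [← hS] at ha
      induction ha using Submodule.span_induction with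
      | mem x hx => exact Submodule.subset_span ⟨x, hx, rfl⟩
      | zero => rw [map_zero]; exact zero_mem _
      | add x y _ _ hx hy => rw [map_add]; exact Submodule.add_mem _ hx hy
      | smul r x hx' hx =>
        rw [hS, mem_augmentationIdeal_iff] at hx'
        obtain ⟨c, hc⟩ := hconn.exists_algebraMap_eq (unop r)
        have h2 : GradedRing.proj 𝒜 1 (r • x) = c • GradedRing.proj 𝒜 1 x := by
          have h3 : (DirectSum.decompose 𝒜 x 0 : A) = 0 := hx'
          have h4 : (DirectSum.decompose 𝒜 (unop r) 0 : A) = algebraMap k A c := hc.symm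
          have h5 : r • x = x * unop r := rfl
          rw [h5, GradedRing.proj_apply, DirectSum.decompose_mul,
            DirectSum.coe_mul_apply_eq_sum_antidiagonal, Finset.Nat.antidiagonal_succ]
          simp only [Finset.Nat.antidiagonal_zero, Finset.sum_cons, Finset.map_singleton,
            Finset.sum_singleton, h3, zero_mul, zero_add]
          change _ * (DirectSum.decompose 𝒜 (unop r) 0 : A) = _
          rw [h4, ← Algebra.commutes, Algebra.smul_def]
          rfl
        rw [h2]
        exact Submodule.smul_mem _ _ hx
    intro a ha
    have h1 := h a (Submodule.subset_span ⟨1, one_pos, ha⟩)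
    rwa [show GradedRing.proj 𝒜 1 a = a from DirectSum.decompose_of_mem_same 𝒜 ha] at h1

end GeneratedInDegreeOne

/-! ### Fox derivatives and syzygies of the components -/

section FoxDerivative

variable {k A : Type*} [Field k] [Ring A] [Algebra k A] {ι : Type*}
  {𝒜 : ℕ → Submodule k A}

/-- The right action of a vector of degree one on `k × A^ι`, given by
`(c, m) · v = (0, c • coords v + m v)`. -/
noncomputable def foxStep (b : Module.Basis ι k (𝒜 1)) :
    𝒜 1 →ₗ[k] (k × (ι → A)) →ₗ[k] (k × (ι → A)) :=
  LinearMap.mk₂ k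
    (fun v p => (0, fun l => algebraMap k A (p.1 * b.repr v l) + p.2 l * (v : A)))
    (fun v w p => by
      ext
      · simp
      · simp [mul_add]
        abel)
    (fun c v p => by
      ext
      · simp
      · simp only [map_smul, Finsupp.smul_apply, Submodule.coe_smul, Prod.smul_mk, Pi.smul_apply,
          smul_add, mul_smul_comm, smul_eq_mul]
        rw [mul_left_comm, map_mul, ← Algebra.smul_def])
    (fun v p q => by
      ext
      · simp
      · simp [add_mul]
        abel)
    (fun c v p => by
      ext
      · simp
      · simp [Algebra.smul_def, mul_assoc, mul_add])

/-- The right action of the tensor algebra on `k × A^ι` that encodes the Fox derivatives. -/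
noncomputable def foxAction (b : Module.Basis ι k (𝒜 1)) :
    TensorAlgebra k (𝒜 1) →ₐ[k] (Module.End k (k × (ι → A)))ᵐᵒᵖ :=
  TensorAlgebra.lift k ((opLinearEquiv k).toLinearMap ∘ₗ foxStep b)

variable (b : Module.Basis ι k (𝒜 1))

theorem foxAction_mul (s t : TensorAlgebra k (𝒜 1)) (p : k × (ι → A)) :
    unop (foxAction b (s * t)) p = unop (foxAction b t) (unop (foxAction b s) p) := by
  rw [map_mul, unop_mul]
  rfl

theorem foxAction_add (s t : TensorAlgebra k (𝒜 1)) (p : k × (ι → A)) :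
    unop (foxAction b (s + t)) p = unop (foxAction b s) p + unop (foxAction b t) p := by
  rw [map_add, unop_add]
  rfl

theorem foxAction_algebraMap (c : k) (p : k × (ι → A)) :
    unop (foxAction b (algebraMap k _ c)) p = c • p := by
  rw [AlgHom.commutes]
  rfl

theorem foxAction_ι (v : 𝒜 1) (p : k × (ι → A)) :
    unop (foxAction b (TensorAlgebra.ι k v)) p =
      (0, fun l => algebraMap k A (p.1 * b.repr v l) + p.2 l * (v : A)) := by
  rw [foxAction, TensorAlgebra.lift_ι_apply]
  rfl

theorem tensorToAlgebra_ι (v : 𝒜 1) : tensorToAlgebra 𝒜 (TensorAlgebra.ι k v) = v :=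
  TensorAlgebra.lift_ι_apply _ _

/-- Once the scalar coordinate vanishes, no new derivative terms arise and the action factors
through right multiplication by A. -/
theorem foxAction_zero_left (t : TensorAlgebra k (𝒜 1)) (m : ι → A) :
    unop (foxAction b t) (0, m) = (0, op (tensorToAlgebra 𝒜 t) • m) := by
  induction t using TensorAlgebra.induction generalizing m with
  | algebraMap c =>
    rw [foxAction_algebraMap, AlgHom.commutes]
    ext
    · simp
    · simp [Algebra.smul_def, Algebra.commutes]
  | ι v =>
    rw [foxAction_ι, tensorToAlgebra_ι]
    ext
    · rfl
    · simp
  | mul s t hs ht => rw [foxAction_mul, hs, ht, map_mul, op_mul, mul_smul]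
  | add s t hs ht => rw [foxAction_add, hs, ht, map_add, op_add, add_smul, Prod.mk_add_mk, add_zero]

/-- The scalar coordinate is acted on through the augmentation; in particular, relations annihilate
it. -/
theorem foxAction_fst [GradedAlgebra 𝒜] (t : TensorAlgebra k (𝒜 1)) (p : k × (ι → A)) :
    algebraMap k A (unop (foxAction b t) p).1 =
      algebraMap k A p.1 * GradedRing.projZeroRingHom 𝒜 (tensorToAlgebra 𝒜 t) := by
  induction t using TensorAlgebra.induction generalizing p with
  | algebraMap c =>
    rw [foxAction_algebraMap, AlgHom.commutes, projZeroRingHom_algebraMap, Prod.smul_fst,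
      smul_eq_mul, mul_comm, map_mul]
  | ι v =>
    rw [foxAction_ι, tensorToAlgebra_ι, map_zero,
      show GradedRing.projZeroRingHom 𝒜 (v : A) = 0 from
        DirectSum.decompose_of_mem_ne 𝒜 v.2 one_ne_zero, mul_zero]
  | mul s t hs ht => rw [foxAction_mul, ht, hs, map_mul, map_mul, mul_assoc]
  | add s t hs ht => rw [foxAction_add, Prod.fst_add, map_add, hs, ht, map_add, map_add, mul_add]

variable [Fintype ι]

/-- The pair (c, m) stands for the element c + ∑ b_l m_l of A, and the action covers right
multiplication. At (1, 0) this is the fundamental formula of Fox calculus, with derivatives taken in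
A; a relation thus gives a syzygy of b. -/
theorem add_rightComb_foxAction (t : TensorAlgebra k (𝒜 1)) (p : k × (ι → A)) :
    algebraMap k A (unop (foxAction b t) p).1 +
        rightComb A (fun l => (b l : A)) (unop (foxAction b t) p).2 =
      (algebraMap k A p.1 + rightComb A (fun l => (b l : A)) p.2) * tensorToAlgebra 𝒜 t := by
  induction t using TensorAlgebra.induction generalizing p with
  | algebraMap c =>
    rw [foxAction_algebraMap, AlgHom.commutes]
    simp only [rightComb_self_apply, Prod.smul_fst, Prod.smul_snd, Pi.smul_apply, smul_eq_mul,
      map_mul, mul_smul_comm]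
    rw [← Finset.smul_sum, Algebra.smul_def, add_mul]
    exact congrArg₂ (· + ·) (Algebra.commutes (A := A) c _) (Algebra.commutes (A := A) c _)
  | ι v =>
    rw [foxAction_ι, tensorToAlgebra_ι]
    simp only [rightComb_self_apply, map_zero, zero_add, mul_add, Finset.sum_add_distrib, add_mul,
      Finset.sum_mul, mul_assoc]
    congr 1
    have h : (v : A) = ∑ l, algebraMap k A (b.repr v l) * (b l : A) := by
      conv_lhs => rw [← b.sum_repr v]
      rw [AddSubmonoidClass.coe_finsetSum]
      exact Finset.sum_congr rfl fun l _ => Algebra.smul_def _ _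
    conv_rhs => rw [h]
    rw [Finset.mul_sum]
    refine Finset.sum_congr rfl fun l _ => ?_
    rw [map_mul, ← map_mul, ← Algebra.commutes, map_mul, mul_assoc]
  | mul s t hs ht => rw [foxAction_mul, ht, hs, map_mul, mul_assoc]
  | add s t hs ht =>
    have h : ∀ a₁ a₂ b₁ b₂ : A, a₁ + a₂ + (b₁ + b₂) = (a₁ + b₁) + (a₂ + b₂) := by
      intros
      abel
    rw [foxAction_add, Prod.fst_add, Prod.snd_add, map_add, map_add, h, hs, ht, map_add, mul_add]

variable [GradedAlgebra 𝒜]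

/-- If `A` has finitely many relations, then the right module of syzygies of a basis of `A₁` is
finitely generated (by the Fox derivatives of the relations). -/
theorem IsConnectedGraded.fg_ker_rightComb_basis (hconn : IsConnectedGraded 𝒜)
    (hgen : GeneratedInDegreeOne 𝒜) (hrel : HasFinitelyManyRelations 𝒜) :
    (LinearMap.ker (rightComb A fun l => (b l : A))).FG := by
  classical
  obtain ⟨R, hR, hspan⟩ := hrel
  let S : Submodule Aᵐᵒᵖ (ι → A) :=
    Submodule.span Aᵐᵒᵖ ((fun ρ => (unop (foxAction b ρ) (1, 0)).2) '' R)
  have hker : ∀ ρ ∈ TwoSidedIdeal.span R, tensorToAlgebra 𝒜 ρ = 0 := by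
    intro ρ hρ
    rw [hspan] at hρ
    exact (TwoSidedIdeal.mem_ker _).mp hρ
  have hfst : ∀ ρ ∈ TwoSidedIdeal.span R, ∀ p, (unop (foxAction b ρ) p).1 = 0 := by
    intro ρ hρ p
    apply hconn.1
    rw [foxAction_fst, hker ρ hρ, map_zero, mul_zero, map_zero]
  -- Quantifying over all p makes left multiples immediate, since a left factor only changes p;
  -- right multiples use that the scalar coordinate is already 0.
  have hmem : ∀ t ∈ TwoSidedIdeal.span R, ∀ p, (unop (foxAction b t) p).2 ∈ S := by
    intro t ht
    induction ht using TwoSidedIdeal.span_induction with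
    | mem ρ hρ =>
      intro p
      have h1 : p = p.1 • ((1 : k), (0 : ι → A)) + (0, p.2) := by
        ext <;> simp
      rw [h1, map_add, foxAction_zero_left, hker ρ (TwoSidedIdeal.subset_span hρ), map_smul,
        op_zero, zero_smul, Prod.mk_zero_zero, add_zero, Prod.smul_snd]
      have h2 : ∀ y : ι → A, p.1 • y = op (algebraMap k A p.1) • y := by
        intro y
        funext l
        simp [Algebra.smul_def, Algebra.commutes]
      rw [h2]
      exact S.smul_mem _ (Submodule.subset_span ⟨ρ, hρ, rfl⟩)
    | zero =>
      intro p
      rw [map_zero]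
      exact S.zero_mem
    | add x y _ _ hx hy =>
      intro p
      rw [foxAction_add]
      exact S.add_mem (hx p) (hy p)
    | neg x _ hx =>
      intro p
      rw [map_neg]
      exact S.neg_mem (hx p)
    | left_absorb a x _ hx =>
      intro p
      rw [foxAction_mul]
      exact hx _
    | right_absorb c x hx' hx =>
      intro p
      have h1 : unop (foxAction b x) p = (0, (unop (foxAction b x) p).2) :=
        Prod.ext (hfst x hx' p) rfl
      rw [foxAction_mul, h1, foxAction_zero_left]
      exact S.smul_mem _ (hx p)
  have hS : LinearMap.ker (rightComb A fun l => (b l : A)) = S := by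
    apply le_antisymm
    · intro y hy
      -- Lift the syzygy y to z: then ∑ b_l z_l is a relation, and its vector of Fox derivatives,
      -- read in A, is y itself.
      choose z hz using fun l => tensorToAlgebra_surjective hgen (y l)
      have h1 : ∑ l, TensorAlgebra.ι k (b l) * z l ∈ TwoSidedIdeal.span R := by
        rw [hspan, TwoSidedIdeal.mem_ker, map_sum]
        refine Eq.trans (Finset.sum_congr rfl fun l _ => ?_) hy
        rw [map_mul, hz, tensorToAlgebra_ι]
        rfl
      have h2 := hmem _ h1 (1, 0)
      have h3 : ∀ s : Finset ι, unop (foxAction b (∑ l ∈ s, TensorAlgebra.ι k (b l) * z l)) (1, 0) =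
          (0, ∑ l ∈ s, Pi.single l (y l)) := by
        intro s
        induction s using Finset.induction_on with
        | empty =>
          rw [Finset.sum_empty, Finset.sum_empty, map_zero]
          rfl
        | insert l s hl ih =>
          rw [Finset.sum_insert hl, Finset.sum_insert hl, foxAction_add, ih, foxAction_mul,
            foxAction_ι, foxAction_zero_left, hz, Prod.mk_add_mk, add_zero]
          congr 2
          funext j
          simp [Finsupp.single_apply, Pi.single_apply, eq_comm]
      rw [h3, Finset.univ_sum_single] at h2
      exact h2
    · rw [Submodule.span_le]
      rintro _ ⟨ρ, hρ, rfl⟩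
      have hρ' := TwoSidedIdeal.subset_span hρ
      have h1 := add_rightComb_foxAction b ρ (1, 0)
      rw [hker ρ hρ', hfst ρ hρ', mul_zero, map_zero, zero_add] at h1
      exact h1
  rw [hS]
  exact Submodule.fg_span (hR.image _)

/-- If `A` has finitely many relations and `A₁` is finite dimensional, then every component `A_u`
has a finite spanning family whose right module of syzygies is finitely generated. -/
theorem IsConnectedGraded.exists_spanning_fg_ker (hconn : IsConnectedGraded 𝒜)
    (hgen : GeneratedInDegreeOne 𝒜) (hrel : HasFinitelyManyRelations 𝒜) (h1 : (𝒜 1).FG) (u : ℕ) :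
    ∃ (r : ℕ) (v : Fin r → A), Submodule.span k (Set.range v) = 𝒜 u ∧
      (LinearMap.ker (rightComb A v)).FG := by
  suffices h : ∃ (ι : Type) (_ : Fintype ι) (v : ι → A), Submodule.span k (Set.range v) = 𝒜 u ∧
      (LinearMap.ker (rightComb A v)).FG by
    obtain ⟨ι, _, v, hv, hker⟩ := h
    refine ⟨Fintype.card ι, v ∘ (Fintype.equivFin ι).symm, ?_, ?_⟩
    · rw [EquivLike.range_comp]
      exact hv
    · apply fg_ker_rightComb_equiv (Fintype.equivFin ι)
      convert hker
      funext i
      simp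
  have := (Submodule.fg_iff_finiteDimensional _).mp h1
  let b := Module.finBasis k (𝒜 1)
  let x : Fin (Module.finrank k (𝒜 1)) → A := fun l => b l
  have hx : Submodule.span k (Set.range x) = 𝒜 1 := by
    have h2 : Set.range x = (𝒜 1).subtype '' Set.range b := by
      rw [← Set.range_comp]
      rfl
    rw [h2, Submodule.span_image, b.span_eq, Submodule.map_top, Submodule.range_subtype]
  have hxker : (LinearMap.ker (rightComb A x)).FG := hconn.fg_ker_rightComb_basis b hgen hrel
  induction u with
  | zero =>
    refine ⟨Unit, inferInstance, fun _ => 1, ?_, ?_⟩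
    · rw [Set.range_const, hconn.piece_zero_eq_one, Submodule.one_eq_span]
    · have h2 : LinearMap.ker (rightComb A fun _ : Unit => (1 : A)) = ⊥ := by
        rw [LinearMap.ker_eq_bot']
        intro m hm
        rw [rightComb_self_apply] at hm
        funext i
        simpa using hm
      rw [h2]
      exact Submodule.fg_bot
  | succ u ih =>
    obtain ⟨κ, _, v, hv, hvker⟩ := ih
    refine ⟨κ × Fin (Module.finrank k (𝒜 1)), inferInstance, fun q => v q.1 * x q.2, ?_, ?_⟩
    · refine Eq.trans ?_ ((congrArg₂ (· * ·) hv hx).trans (hconn.piece_add hgen u 1).symm)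
      rw [Submodule.span_mul_span]
      congr 1
      ext a
      simp [Set.mem_mul]
    -- Contracting the second index against x sends syzygies of the products to syzygies of v. The
    -- kernel of Ψ is a finite power of the syzygies of x, and the image contains every syzygy of v
    -- times `A₊`; both are finitely generated.
    · let Ψ : (κ × Fin (Module.finrank k (𝒜 1)) → A) →ₗ[Aᵐᵒᵖ] (κ → A) :=
        (rightComb A x).compLeft κ ∘ₗ (LinearEquiv.curry Aᵐᵒᵖ A κ _).toLinearMap
      have hΨ : ∀ y w, Ψ y w = rightComb A x fun l => y (w, l) := fun _ _ => rfl
      have hcomp : LinearMap.ker (rightComb A fun q : κ × Fin (Module.finrank k (𝒜 1)) =>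
          v q.1 * x q.2) = (LinearMap.ker (rightComb A v)).comap Ψ := by
        ext y
        rw [Submodule.mem_comap, LinearMap.mem_ker, LinearMap.mem_ker, rightComb_self_apply,
          rightComb_self_apply, Fintype.sum_prod_type]
        simp only [hΨ, rightComb_self_apply, Finset.mul_sum, mul_assoc]
      rw [hcomp]
      refine Submodule.fg_of_fg_map_of_fg_inf_ker Ψ ?_ ?_
      · refine hconn.fg_of_smul_augmentationIdeal_le (hconn.augmentationIdeal_fg hgen h1) hvker
          (Submodule.map_comap_le _ _) fun z hz a ha => ?_
        have h3 : ∀ w, ∃ y : Fin _ → A, rightComb A x y = z w * a := by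
          intro w
          have h4 := mul_mem_augmentationIdeal (z w) ha
          rw [← hconn.range_rightComb_eq hgen hx] at h4
          exact h4
        choose y hy using h3
        have h5 : Ψ (fun q => y q.1 q.2) = op a • z := by
          funext w
          rw [hΨ]
          exact hy w
        refine ⟨fun q => y q.1 q.2, ?_, h5⟩
        rw [SetLike.mem_coe, Submodule.mem_comap, h5]
        exact Submodule.smul_mem _ _ hz
      · have h6 : (LinearMap.ker (rightComb A v)).comap Ψ ⊓ LinearMap.ker Ψ =
            (Submodule.pi Set.univ fun _ : κ => LinearMap.ker (rightComb A x)).map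
              (LinearEquiv.curry Aᵐᵒᵖ A κ _).symm.toLinearMap := by
          have h7 : LinearMap.ker Ψ ≤ (LinearMap.ker (rightComb A v)).comap Ψ :=
            Submodule.comap_mono bot_le
          rw [inf_eq_right.mpr h7]
          ext y
          constructor
          · intro hy
            exact ⟨fun w l => y (w, l), fun w _ => congrFun hy w, rfl⟩
          · rintro ⟨z, hz, rfl⟩
            funext w
            exact hz w trivial
        rw [h6]
        exact (Submodule.fg_pi fun _ => hxker).map _

end FoxDerivative

/-! ### Finite dimensionality of the degree-one component -/

section FiniteDimensionality

theorem TensorAlgebra.exists_fg_mem_adjoin {k V : Type*} [Field k] [AddCommGroup V] [Module k V]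
    (t : TensorAlgebra k V) :
    ∃ W : Submodule k V, W.FG ∧ t ∈ Algebra.adjoin k (TensorAlgebra.ι k '' (W : Set V)) := by
  have hmono : ∀ W₁ W₂ : Submodule k V, W₁ ≤ W₂ →
      Algebra.adjoin k (TensorAlgebra.ι k '' (W₁ : Set V)) ≤
        Algebra.adjoin k (TensorAlgebra.ι k '' (W₂ : Set V)) :=
    fun _ _ h => Algebra.adjoin_mono (Set.image_mono h)
  induction t using TensorAlgebra.induction with
  | algebraMap c => exact ⟨⊥, Submodule.fg_bot, Subalgebra.algebraMap_mem _ c⟩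
  | ι v =>
    exact ⟨Submodule.span k {v}, Submodule.fg_span_singleton v,
      Algebra.subset_adjoin ⟨v, Submodule.mem_span_singleton_self v, rfl⟩⟩
  | mul s t hs ht =>
    obtain ⟨W₁, h₁, hs⟩ := hs
    obtain ⟨W₂, h₂, ht⟩ := ht
    exact ⟨W₁ ⊔ W₂, h₁.sup h₂,
      Subalgebra.mul_mem _ (hmono _ _ le_sup_left hs) (hmono _ _ le_sup_right ht)⟩
  | add s t hs ht =>
    obtain ⟨W₁, h₁, hs⟩ := hs
    obtain ⟨W₂, h₂, ht⟩ := ht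
    exact ⟨W₁ ⊔ W₂, h₁.sup h₂,
      Subalgebra.add_mem _ (hmono _ _ le_sup_left hs) (hmono _ _ le_sup_right ht)⟩

theorem MvPolynomial.linearIndependent_X_pow (σ k : Type*) [CommSemiring k] {n : ℕ} (hn : n ≠ 0) :
    LinearIndependent k fun j : σ => (MvPolynomial.X j : MvPolynomial σ k) ^ n := by
  have h := (MvPolynomial.basisMonomials σ k).linearIndependent.comp
    (fun j => Finsupp.single j n) (Finsupp.single_left_injective hn)
  have h1 : (fun j : σ => (MvPolynomial.X j : MvPolynomial σ k) ^ n) =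
      MvPolynomial.basisMonomials σ k ∘ fun j => Finsupp.single j n := by
    funext j
    rw [MvPolynomial.X_pow_eq_monomial]
    simp
  rw [h1]
  exact h

variable {k A : Type*} [Field k] [Ring A] [Algebra k A] {𝒜 : ℕ → Submodule k A}

/-- Relations between letters in `W` are killed by every algebra map that kills `W`. -/
theorem IsConnectedGraded.lift_eq_zero [GradedAlgebra 𝒜] (hconn : IsConnectedGraded 𝒜)
    {C : Type*} [Ring C] [Algebra k C] {W : Submodule k (𝒜 1)} {φ : 𝒜 1 →ₗ[k] C}
    (hφ : ∀ v ∈ W, φ v = 0) {t : TensorAlgebra k (𝒜 1)}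
    (ht : t ∈ Algebra.adjoin k (TensorAlgebra.ι k '' (W : Set (𝒜 1))))
    (ht0 : tensorToAlgebra 𝒜 t = 0) : TensorAlgebra.lift k φ t = 0 := by
  -- On the subalgebra generated by W, both maps see only the constant term c of t.
  have h : ∃ c : k, TensorAlgebra.lift k φ t = algebraMap k C c ∧
      GradedRing.projZeroRingHom 𝒜 (tensorToAlgebra 𝒜 t) = algebraMap k A c := by
    clear ht0
    induction ht using Algebra.adjoin_induction with
    | mem x hx =>
      obtain ⟨v, hv, rfl⟩ := hx
      refine ⟨0, ?_, ?_⟩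
      · rw [TensorAlgebra.lift_ι_apply, hφ v hv, map_zero]
      · rw [tensorToAlgebra_ι, map_zero]
        exact DirectSum.decompose_of_mem_ne 𝒜 v.2 one_ne_zero
    | algebraMap c =>
      exact ⟨c, AlgHom.commutes _ _, by rw [AlgHom.commutes, projZeroRingHom_algebraMap]⟩
    | add x y _ _ hx hy =>
      obtain ⟨c, hc, hc'⟩ := hx
      obtain ⟨d, hd, hd'⟩ := hy
      exact ⟨c + d, by rw [map_add, map_add, hc, hd], by rw [map_add, map_add, map_add, hc', hd']⟩
    | mul x y _ _ hx hy =>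
      obtain ⟨c, hc, hc'⟩ := hx
      obtain ⟨d, hd, hd'⟩ := hy
      exact ⟨c * d, by rw [map_mul, map_mul, hc, hd], by rw [map_mul, map_mul, map_mul, hc', hd']⟩
  obtain ⟨c, hc, hc'⟩ := h
  rw [ht0, map_zero] at hc'
  have hc0 : c = 0 := hconn.1 (by rw [← hc', map_zero])
  rw [hc, hc0, map_zero]

/-- For an algebra with finitely many relations, if some component of positive degree is finite
dimensional, then so is `A₁`. -/
theorem IsConnectedGraded.piece_one_fg_of_piece_fg [GradedAlgebra 𝒜]
    (hconn : IsConnectedGraded 𝒜) (hgen : GeneratedInDegreeOne 𝒜)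
    (hrel : HasFinitelyManyRelations 𝒜) {n : ℕ} (hn : n ≠ 0) (hfg : (𝒜 n).FG) : (𝒜 1).FG := by
  obtain ⟨R, hR, hspan⟩ := hrel
  obtain ⟨W, hW, hRW⟩ : ∃ W : Submodule k (𝒜 1), W.FG ∧
      ∀ ρ ∈ R, ρ ∈ Algebra.adjoin k (TensorAlgebra.ι k '' (W : Set (𝒜 1))) := by
    choose W hW hmem using TensorAlgebra.exists_fg_mem_adjoin (k := k) (V := 𝒜 1)
    have := hR.to_subtype
    refine ⟨⨆ ρ : R, W ρ, Submodule.fg_iSup _ fun ρ => hW ρ, fun ρ hρ => ?_⟩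
    exact Algebra.adjoin_mono (Set.image_mono (le_iSup (fun ρ : R => W ρ) ⟨ρ, hρ⟩)) (hmem ρ)
  let b := Module.Basis.ofVectorSpace k (𝒜 1 ⧸ W)
  -- Since φ kills W, its extension to the tensor algebra kills all relations and so descends to A;
  -- the descended map is realized below through a linear section s.
  let φ : 𝒜 1 →ₗ[k] MvPolynomial (Module.Basis.ofVectorSpaceIndex k (𝒜 1 ⧸ W)) k :=
    b.constr k MvPolynomial.X ∘ₗ W.mkQ
  have hφ : ∀ v ∈ W, φ v = 0 := by
    intro v hv
    rw [LinearMap.comp_apply, Submodule.mkQ_apply, (Submodule.Quotient.mk_eq_zero _).mpr hv,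
      map_zero]
  have hker : ∀ t, tensorToAlgebra 𝒜 t = 0 → TensorAlgebra.lift k φ t = 0 := by
    intro t ht
    have h1 : TwoSidedIdeal.span R ≤ TwoSidedIdeal.ker (TensorAlgebra.lift k φ) := by
      rw [TwoSidedIdeal.span_le]
      intro ρ hρ
      refine (TwoSidedIdeal.mem_ker _).mpr (hconn.lift_eq_zero hφ (hRW ρ hρ) ?_)
      rw [← TwoSidedIdeal.mem_ker, ← hspan]
      exact TwoSidedIdeal.subset_span hρ
    refine (TwoSidedIdeal.mem_ker _).mp (h1 ?_)
    rw [hspan]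
    exact (TwoSidedIdeal.mem_ker _).mpr ht
  obtain ⟨s, hs⟩ := LinearMap.exists_rightInverse_of_surjective (tensorToAlgebra 𝒜).toLinearMap
    (LinearMap.range_eq_top.mpr (tensorToAlgebra_surjective hgen))
  have hψ : ∀ t, TensorAlgebra.lift k φ (s (tensorToAlgebra 𝒜 t)) = TensorAlgebra.lift k φ t := by
    intro t
    rw [← sub_eq_zero, ← map_sub]
    apply hker
    rw [map_sub, sub_eq_zero]
    exact LinearMap.congr_fun hs (tensorToAlgebra 𝒜 t)
  choose σ hσ using fun j => Submodule.Quotient.mk_surjective W (b j)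
  let y : Module.Basis.ofVectorSpaceIndex k (𝒜 1 ⧸ W) → 𝒜 n := fun j =>
    ⟨(σ j : A) ^ n, by simpa using SetLike.pow_mem_graded n (σ j).2⟩
  have hy : LinearIndependent k y := by
    refine LinearIndependent.of_comp
      ((TensorAlgebra.lift k φ).toLinearMap ∘ₗ s ∘ₗ (𝒜 n).subtype) ?_
    have h2 : ((TensorAlgebra.lift k φ).toLinearMap ∘ₗ s ∘ₗ (𝒜 n).subtype) ∘ y =
        fun j => MvPolynomial.X j ^ n := by
      funext j
      change TensorAlgebra.lift k φ (s ((σ j : A) ^ n)) = _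
      rw [← tensorToAlgebra_ι (σ j), ← map_pow, hψ, map_pow, TensorAlgebra.lift_ι_apply,
        LinearMap.comp_apply, Submodule.mkQ_apply, hσ, b.constr_basis]
    rw [h2]
    exact MvPolynomial.linearIndependent_X_pow _ k hn
  have := (Submodule.fg_iff_finiteDimensional _).mp hfg
  have := hy.finite
  have := (Submodule.fg_iff_finiteDimensional _).mp hW
  have : Module.Finite k (𝒜 1 ⧸ W) := Module.Finite.of_basis b
  exact (Submodule.fg_iff_finiteDimensional _).mpr (Module.Finite.of_submodule_quotient W)

end FiniteDimensionality

/-! ### Syzygies over a subalgebra -/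

section SubalgebraCombinations

variable {k A : Type*} [Field k] [Ring A] [Algebra k A] {B : Subalgebra k A}
  {ι : Type*} [Fintype ι]

/-- The additive map `B^ι → A`, `y ↦ ∑ cᵢ yᵢ`, for a subalgebra `B` of `A`. -/
def subComb (B : Subalgebra k A) (c : ι → A) : (ι → B) →+ A where
  toFun y := ∑ i, c i * (y i : A)
  map_zero' := by simp
  map_add' x y := by simp [mul_add, Finset.sum_add_distrib]

theorem subComb_apply (c : ι → A) (y : ι → B) : subComb B c y = ∑ i, c i * (y i : A) := rfl

theorem subComb_single [DecidableEq ι] (c : ι → A) (i : ι) (b : B) :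
    subComb B c (Pi.single i b) = c i * b := by
  rw [subComb_apply, Finset.sum_eq_single i]
  · simp
  · intro j _ hj
    simp [Pi.single_eq_of_ne hj]
  · simp

theorem subComb_smul (c : ι → A) (b : Bᵐᵒᵖ) (y : ι → B) :
    subComb B c (b • y) = subComb B c y * (unop b : B) := by
  rw [subComb_apply, subComb_apply, Finset.sum_mul]
  exact Finset.sum_congr rfl fun i _ => (mul_assoc _ _ _).symm

theorem coe_rightComb (c : ι → B) (y : ι → B) :
    (rightComb B c y : A) = subComb B (fun i => (c i : A)) y := by
  rw [rightComb_self_apply, subComb_apply, AddSubmonoidClass.coe_finsetSum]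
  rfl

theorem subComb_rightComb {κ : Type*} [Fintype κ] (c : ι → A) (g : κ → ι → B) (z : κ → B) :
    subComb B c (rightComb B g z) = subComb B (fun t => subComb B c (g t)) z := by
  rw [rightComb_apply, map_sum]
  exact Finset.sum_congr rfl fun t _ => subComb_smul _ _ _

/-- The right `B`-module of syzygies over `B` of a family in `A`. -/
def subSyzygies (B : Subalgebra k A) (c : ι → A) : Submodule Bᵐᵒᵖ (ι → B) where
  carrier := {y | subComb B c y = 0}
  zero_mem' := map_zero _
  add_mem' {x y} hx hy := by
    rw [Set.mem_ofPred_eq] at hx hy ⊢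
    rw [map_add, hx, hy, add_zero]
  smul_mem' b y hy := by
    rw [Set.mem_ofPred_eq] at hy ⊢
    rw [subComb_smul, hy, zero_mul]

theorem mem_subSyzygies {c : ι → A} {y : ι → B} : y ∈ subSyzygies B c ↔ subComb B c y = 0 :=
  Iff.rfl

/-- If `A` is finitely generated over `B` and the `B`-syzygies of all families `a_s w_j`, with
`w_j` the generators, are finitely generated, then so are the `A`-syzygies of `a`. -/
theorem fg_ker_rightComb_of_subSyzygies {κ : Type*} [Fintype κ] {w : κ → A}
    (hw : Function.Surjective (subComb B w)) (a : ι → A)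
    (h : (subSyzygies B fun q : ι × κ => a q.1 * w q.2).FG) :
    (LinearMap.ker (rightComb A a)).FG := by
  obtain ⟨p, G, hG⟩ := fg_iff_exists_rightComb.mp h
  have hT : ∀ y : ι × κ → B, subComb B (fun q : ι × κ => a q.1 * w q.2) y =
      rightComb A a fun s => subComb B w fun j => y (s, j) := by
    intro y
    rw [rightComb_self_apply, subComb_apply, Fintype.sum_prod_type]
    refine Finset.sum_congr rfl fun s _ => ?_
    rw [subComb_apply, Finset.mul_sum]
    exact Finset.sum_congr rfl fun j _ => mul_assoc _ _ _
  -- Contract the index j of each generating B-syzygy against w to get an A-syzygy of a. All arise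
  -- this way, since the entries of an A-syzygy can be expanded over B in w.
  refine fg_iff_exists_rightComb.mpr ⟨p, fun t s => subComb B w fun j => G t (s, j), ?_⟩
  apply le_antisymm
  · rw [range_rightComb, Submodule.span_le]
    rintro _ ⟨t, rfl⟩
    have h1 : G t ∈ subSyzygies B fun q : ι × κ => a q.1 * w q.2 := by
      rw [← hG, range_rightComb]
      exact Submodule.subset_span ⟨t, rfl⟩
    rw [mem_subSyzygies, hT] at h1
    exact h1
  · intro x hx
    choose y hy using fun s => hw (x s)
    have h1 : (fun q : ι × κ => y q.1 q.2) ∈ subSyzygies B fun q : ι × κ => a q.1 * w q.2 := by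
      rw [mem_subSyzygies, hT]
      simp only [hy]
      exact hx
    rw [← hG] at h1
    obtain ⟨z, hz⟩ := h1
    refine ⟨fun t => z t, ?_⟩
    funext s
    rw [rightComb_pi_apply, ← hy s]
    have h2 : y s = rightComb B (fun t j => G t (s, j)) z := by
      funext j
      rw [rightComb_pi_apply, ← rightComb_pi_apply G z (s, j), hz]
    rw [h2, subComb_rightComb]
    rfl

end SubalgebraCombinations

/-! ### Projections by residue and the retraction onto the Veronese subalgebra -/

section ResidueProjection

variable {k A : Type*} [Field k] [Ring A] [Algebra k A]
  (𝒜 : ℕ → Submodule k A) [GradedAlgebra 𝒜] (n : ℕ)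

/-- The projection onto the sum of the components whose degree has residue `r` modulo `n`. -/
def residueProj (r : ZMod n) : A →+ A :=
  (DirectSum.toAddMonoid fun i : ℕ =>
    if (i : ZMod n) = r then (𝒜 i).subtype.toAddMonoidHom else 0).comp
    (DirectSum.decomposeAddEquiv 𝒜).toAddMonoidHom

variable {n}

theorem residueProj_of_mem {i : ℕ} {a : A} (ha : a ∈ 𝒜 i) (r : ZMod n) :
    residueProj 𝒜 n r a = if (i : ZMod n) = r then a else 0 := by
  change DirectSum.toAddMonoid _ (DirectSum.decompose 𝒜 a) = _
  rw [DirectSum.decompose_of_mem 𝒜 ha, DirectSum.toAddMonoid_of]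
  split_ifs <;> rfl

theorem residueProj_mul_left {i : ℕ} {a : A} (ha : a ∈ 𝒜 i) (r : ZMod n) (x : A) :
    residueProj 𝒜 n (i + r) (a * x) = a * residueProj 𝒜 n r x := by
  induction x using DirectSum.Decomposition.inductionOn 𝒜 with
  | zero => rw [mul_zero, map_zero, map_zero, mul_zero]
  | homogeneous x =>
    rw [residueProj_of_mem 𝒜 (SetLike.mul_mem_graded ha x.2), residueProj_of_mem 𝒜 x.2]
    simp only [Nat.cast_add, add_right_inj, mul_ite, mul_zero]
  | add x y hx hy => rw [mul_add, map_add, map_add, mul_add, hx, hy]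

theorem residueProj_mul_right {i : ℕ} {a : A} (ha : a ∈ 𝒜 i) (r : ZMod n) (x : A) :
    residueProj 𝒜 n (r + i) (x * a) = residueProj 𝒜 n r x * a := by
  induction x using DirectSum.Decomposition.inductionOn 𝒜 with
  | zero => rw [zero_mul, map_zero, map_zero, zero_mul]
  | homogeneous x =>
    rw [residueProj_of_mem 𝒜 (SetLike.mul_mem_graded x.2 ha), residueProj_of_mem 𝒜 x.2]
    simp only [Nat.cast_add, add_left_inj, ite_mul, zero_mul]
  | add x y hx hy => rw [add_mul, map_add, map_add, add_mul, hx, hy]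

theorem veronese_induction {p : A → Prop} (h0 : p 0)
    (hmem : ∀ i, n ∣ i → ∀ a ∈ 𝒜 i, p a) (hadd : ∀ a b, p a → p b → p (a + b))
    {a : A} (ha : a ∈ veronese 𝒜 n) : p a := by
  classical
  rw [← DirectSum.sum_support_decompose 𝒜 a]
  refine Finset.sum_induction _ p hadd h0 fun i _ => ?_
  by_cases hi : n ∣ i
  · exact hmem i hi _ (SetLike.coe_mem _)
  · rw [ha i hi]
    exact h0

theorem residueProj_of_mem_veronese {b : A} (hb : b ∈ veronese 𝒜 n) (r : ZMod n) :
    residueProj 𝒜 n r b = if r = 0 then b else 0 := by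
  refine veronese_induction 𝒜 (p := fun b => residueProj 𝒜 n r b = if r = 0 then b else 0)
    ?_ (fun i hi a ha => ?_) (fun a b ha hb => ?_) hb
  · simp
  · rw [residueProj_of_mem 𝒜 ha, (ZMod.natCast_eq_zero_iff i n).mpr hi]
    simp only [eq_comm]
  · rw [map_add, ha, hb]
    split_ifs
    · rfl
    · rw [add_zero]

theorem residueProj_veronese_mul {b : A} (hb : b ∈ veronese 𝒜 n) (r : ZMod n) (x : A) :
    residueProj 𝒜 n r (b * x) = b * residueProj 𝒜 n r x := by
  refine veronese_induction 𝒜 (p := fun b => residueProj 𝒜 n r (b * x) = b * residueProj 𝒜 n r x)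
    ?_ (fun i hi a ha => ?_) (fun a b ha hb => ?_) hb
  · simp
  · have h := residueProj_mul_left 𝒜 ha r x
    rwa [(ZMod.natCast_eq_zero_iff i n).mpr hi, zero_add] at h
  · rw [add_mul, map_add, ha, hb, add_mul]

theorem residueProj_mul_veronese {b : A} (hb : b ∈ veronese 𝒜 n) (r : ZMod n) (x : A) :
    residueProj 𝒜 n r (x * b) = residueProj 𝒜 n r x * b := by
  refine veronese_induction 𝒜 (p := fun b => residueProj 𝒜 n r (x * b) = residueProj 𝒜 n r x * b)
    ?_ (fun i hi a ha => ?_) (fun a b ha hb => ?_) hb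
  · simp
  · have h := residueProj_mul_right 𝒜 ha r x
    rwa [(ZMod.natCast_eq_zero_iff i n).mpr hi, add_zero] at h
  · rw [mul_add, map_add, ha, hb, mul_add]

theorem residueProj_zero_mem (a : A) : residueProj 𝒜 n 0 a ∈ veronese 𝒜 n := by
  induction a using DirectSum.Decomposition.inductionOn 𝒜 with
  | zero => rw [map_zero]; exact zero_mem _
  | @homogeneous i x =>
    rw [residueProj_of_mem 𝒜 x.2]
    split_ifs with hi
    · obtain ⟨c, rfl⟩ := (ZMod.natCast_eq_zero_iff i n).mp hi
      exact mem_veronese_of_mem 𝒜 n c (mul_comm n c ▸ x.2)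
    · exact zero_mem _
  | add x y hx hy => rw [map_add]; exact add_mem hx hy

/-- The retraction of `A` onto its Veronese subalgebra. -/
def veroneseRetraction : A →+ veronese 𝒜 n where
  toFun a := ⟨residueProj 𝒜 n 0 a, residueProj_zero_mem 𝒜 a⟩
  map_zero' := Subtype.ext (map_zero _)
  map_add' x y := Subtype.ext (map_add _ x y)

theorem veroneseRetraction_coe (b : veronese 𝒜 n) : veroneseRetraction 𝒜 (b : A) = b :=
  Subtype.ext ((residueProj_of_mem_veronese 𝒜 b.2 0).trans (if_pos rfl))

theorem veroneseRetraction_mul_coe (a : A) (b : veronese 𝒜 n) :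
    veroneseRetraction 𝒜 (a * b) = veroneseRetraction 𝒜 a * b :=
  Subtype.ext (residueProj_mul_veronese 𝒜 b.2 0 a)

variable {𝒜}

/-- Finite generation descends along the retraction onto the Veronese subalgebra. -/
theorem fg_of_veroneseRetraction {κ σ : Type*} [Fintype κ] {w : κ → A}
    (hw : Function.Surjective (subComb (veronese 𝒜 n) w)) {K : Submodule Aᵐᵒᵖ (σ → A)} (hK : K.FG)
    {L : Submodule (veronese 𝒜 n)ᵐᵒᵖ (σ → veronese 𝒜 n)}
    (h1 : ∀ y ∈ L, (fun s => (y s : A)) ∈ K)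
    (h2 : ∀ z ∈ K, (fun s => veroneseRetraction 𝒜 (z s)) ∈ L) : L.FG := by
  obtain ⟨r, g, hg⟩ := fg_iff_exists_rightComb.mp hK
  have hgK : ∀ t, g t ∈ K := by
    intro t
    rw [← hg, range_rightComb]
    exact Submodule.subset_span ⟨t, rfl⟩
  -- If the g_t generate K over A, then the products g_t w_j generate it over B, and their
  -- retractions generate L.
  have hL : L = LinearMap.range (rightComb (veronese 𝒜 n) fun q : Fin r × κ =>
      fun s => veroneseRetraction 𝒜 (g q.1 s * w q.2)) := by
    apply le_antisymm
    · intro y hy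
      have h3 := h1 y hy
      rw [← hg] at h3
      obtain ⟨z, hz⟩ := h3
      choose β hβ using fun t => hw (z t)
      refine ⟨fun q => β q.1 q.2, ?_⟩
      funext s
      have h4 := congrFun hz s
      rw [rightComb_pi_apply, rightComb_self_apply] at h4
      rw [rightComb_pi_apply, rightComb_self_apply, ← veroneseRetraction_coe 𝒜 (y s), ← h4,
        Fintype.sum_prod_type, map_sum]
      refine Finset.sum_congr rfl fun t _ => ?_
      rw [← hβ, subComb_apply, Finset.mul_sum, map_sum]
      refine Finset.sum_congr rfl fun j _ => ?_
      rw [← mul_assoc, veroneseRetraction_mul_coe]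
    · rw [range_rightComb, Submodule.span_le]
      rintro _ ⟨q, rfl⟩
      exact h2 _ (K.smul_mem (op (w q.2)) (hgK q.1))
  rw [hL, range_rightComb]
  exact Submodule.fg_span (Set.finite_range _)

end ResidueProjection

/-! ### Transfer of finitely generated syzygies between A and its Veronese subalgebra -/

section VeroneseGrading

variable {k A : Type*} [Field k] [Ring A] [Algebra k A]
  {𝒜 : ℕ → Submodule k A} [GradedAlgebra 𝒜] {n : ℕ}

theorem mem_veronesePiece {i : ℕ} {b : veronese 𝒜 n} :
    b ∈ veronesePiece 𝒜 n i ↔ (b : A) ∈ 𝒜 (i * n) := Iff.rfl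

theorem map_veronesePiece (i : ℕ) :
    (veronesePiece 𝒜 n i).map (veronese 𝒜 n).val.toLinearMap = 𝒜 (i * n) := by
  ext a
  constructor
  · rintro ⟨b, hb, rfl⟩
    exact hb
  · intro ha
    exact ⟨⟨a, mem_veronese_of_mem 𝒜 n i ha⟩, ha, rfl⟩

theorem veronesePiece_fg_iff (i : ℕ) : (veronesePiece 𝒜 n i).FG ↔ (𝒜 (i * n)).FG := by
  rw [← map_veronesePiece (𝒜 := 𝒜) (n := n) i]
  exact ⟨fun h => h.map _, fun h => Submodule.fg_of_fg_map_injective _ Subtype.val_injective h⟩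

theorem coe_mem_intPiece {i : ℤ} {b : veronese 𝒜 n} (hb : b ∈ intPiece (veronesePiece 𝒜 n) i) :
    (b : A) ∈ intPiece 𝒜 (i * n) := by
  cases i with
  | ofNat i => exact hb
  | negSucc i =>
    rw [show b = 0 from hb]
    exact zero_mem _

variable [NeZero n]

theorem IsConnectedGraded.on_veronese (hconn : IsConnectedGraded 𝒜) :
    IsConnectedGraded (veronesePiece 𝒜 n) := by
  constructor
  · intro c d h
    exact hconn.1 (congrArg Subtype.val h)
  · ext b
    rw [mem_veronesePiece, zero_mul, hconn.2]
    exact exists_congr fun c => ⟨fun h => Subtype.ext h, congrArg Subtype.val⟩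

theorem GeneratedInDegreeOne.on_veronese (hgen : GeneratedInDegreeOne 𝒜)
    (hconn : IsConnectedGraded 𝒜) : GeneratedInDegreeOne (veronesePiece 𝒜 n) := by
  classical
  let S := Algebra.adjoin k (veronesePiece 𝒜 n 1 : Set (veronese 𝒜 n))
  have h : ∀ i, 𝒜 (i * n) ≤ Subalgebra.toSubmodule (S.map (veronese 𝒜 n).val) := by
    intro i
    induction i with
    | zero =>
      rw [zero_mul, hconn.2]
      rintro _ ⟨c, rfl⟩
      exact Subalgebra.algebraMap_mem _ c
    | succ i ih =>
      rw [add_mul, one_mul, hconn.piece_add hgen, Submodule.mul_le]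
      intro a ha b hb
      refine Subalgebra.mul_mem _ (ih ha) ?_
      rw [← one_mul n] at hb
      exact ⟨⟨b, mem_veronese_of_mem 𝒜 n 1 hb⟩, Algebra.subset_adjoin hb, rfl⟩
  rw [GeneratedInDegreeOne, eq_top_iff]
  intro b _
  rw [← DirectSum.sum_support_decompose (veronesePiece 𝒜 n) b]
  refine Subalgebra.sum_mem _ fun i _ => ?_
  obtain ⟨s, hs, hs'⟩ := h i (SetLike.coe_mem (DirectSum.decompose (veronesePiece 𝒜 n) b i))
  rw [← show s = _ from Subtype.ext hs']
  exact hs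

theorem coe_intProj (i : ℤ) (b : veronese 𝒜 n) :
    (intProj (veronesePiece 𝒜 n) i b : A) = intProj 𝒜 (i * n) (b : A) := by
  classical
  obtain ⟨F, hF⟩ := exists_finset_sum_intProj (veronesePiece 𝒜 n) b
  have h := congrArg Subtype.val (hF (insert i F) (Finset.subset_insert _ _))
  rw [AddSubmonoidClass.coe_finsetSum] at h
  rw [← h, map_sum, Finset.sum_eq_single i]
  · exact (intProj_of_mem 𝒜 (coe_mem_intPiece (intProj_mem _ i b))).symm
  · intro j _ hj
    refine intProj_of_mem_ne 𝒜 (coe_mem_intPiece (intProj_mem _ j b)) fun h => hj ?_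
    exact mul_right_cancel₀ (Nat.cast_ne_zero.mpr (NeZero.ne n)) h
  · intro hi
    exact absurd (Finset.mem_insert_self i F) hi

/-- `A` is finitely generated by homogeneous elements over its Veronese subalgebra. -/
theorem IsConnectedGraded.exists_generators_over_veronese (hconn : IsConnectedGraded 𝒜)
    (hgen : GeneratedInDegreeOne 𝒜) (h1 : (𝒜 1).FG) :
    ∃ (m : ℕ) (e : Fin m → ℕ) (w : Fin m → A), (∀ j, w j ∈ 𝒜 (e j)) ∧
      Function.Surjective (subComb (veronese 𝒜 n) w) := by
  classical
  have hfg : ∀ u, (𝒜 u).FG := fun u => hconn.piece_eq_pow hgen u ▸ h1.pow u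
  choose r v hv using fun u => Submodule.fg_iff_exists_fin_generating_family.mp (hfg u)
  let κ := Σ u : Fin n, Fin (r u)
  let w : κ → A := fun q => v q.1 q.2
  let ε := Fintype.equivFin κ
  refine ⟨Fintype.card κ, fun j => (ε.symm j).1, w ∘ ε.symm, fun j => ?_, ?_⟩
  · rw [← hv]
    exact Submodule.subset_span ⟨_, rfl⟩
  · have hmem : ∀ a, a ∈ (subComb (veronese 𝒜 n) (w ∘ ε.symm)).range := by
      intro a
      induction a using DirectSum.Decomposition.inductionOn 𝒜 with
      | zero => exact zero_mem _
      | @homogeneous i x =>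
        -- The right factor lies in the Veronese subalgebra, so spanning families of `A_u` with u <
        -- n suffice.
        have hx : (x : A) ∈ 𝒜 (i % n) * 𝒜 (i / n * n) := by
          rw [← hconn.piece_add hgen, mul_comm, Nat.mod_add_div]
          exact x.2
        obtain ⟨β, hβ, hβx⟩ := exists_rightComb_of_mem_mul (hv (i % n)) hx
        rw [← hβx, rightComb_self_apply]
        refine AddSubgroup.sum_mem _ fun l _ => ?_
        refine ⟨Pi.single (ε ⟨⟨i % n, Nat.mod_lt _ (NeZero.pos n)⟩, l⟩)
          ⟨β l, mem_veronese_of_mem 𝒜 n _ (hβ l)⟩, ?_⟩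
        rw [subComb_single, Function.comp_apply, Equiv.symm_apply_apply]
      | add x y hx hy => exact add_mem hx hy
    exact hmem

/-- Coherence passes to the Veronese subalgebra. -/
theorem HasFGKernels.on_veronese (h : HasFGKernels 𝒜) (hconn : IsConnectedGraded 𝒜)
    (hgen : GeneratedInDegreeOne 𝒜) (h1 : (𝒜 1).FG) : HasFGKernels (veronesePiece 𝒜 n) := by
  intro r d b hb
  obtain ⟨m, e, w, -, hw⟩ := hconn.exists_generators_over_veronese (n := n) hgen h1
  refine fg_of_veroneseRetraction hw
    (h r (fun s => d s * n) (fun s => (b s : A)) fun s => coe_mem_intPiece (hb s)) ?_ ?_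
  · intro y hy
    exact (coe_rightComb b y).symm.trans (congrArg Subtype.val hy)
  · intro z hz
    apply Subtype.ext
    rw [coe_rightComb, subComb_apply]
    -- The projection commutes with left multiplication by elements of B, so it sends A-syzygies of
    -- b to B-syzygies.
    have h2 := congrArg (residueProj 𝒜 n 0) (LinearMap.mem_ker.mp hz)
    rw [rightComb_self_apply, map_sum, map_zero] at h2
    refine Eq.trans (Finset.sum_congr rfl fun s _ => ?_) h2
    exact (residueProj_veronese_mul 𝒜 (b s).2 0 (z s)).symm

/-- Over a coherent Veronese subalgebra, the syzygies of a family whose degrees have the same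
residue `u` modulo `n` are finitely generated, provided that `A_u` has a spanning family with
finitely generated syzygies. -/
theorem HasFGKernels.subSyzygies_fg_of_residue (h : HasFGKernels (veronesePiece 𝒜 n))
    (hconn : IsConnectedGraded 𝒜) (hgen : GeneratedInDegreeOne 𝒜) {u m : ℕ} {v : Fin m → A}
    (hv : Submodule.span k (Set.range v) = 𝒜 u)
    (hvfg : (subSyzygies (veronese 𝒜 n) v).FG) {ι : Type} [Fintype ι] (i : ι → ℕ) (c : ι → A)
    (hc : ∀ q, c q ∈ 𝒜 (u + i q * n)) : (subSyzygies (veronese 𝒜 n) c).FG := by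
  have hvmem : ∀ l, v l ∈ 𝒜 u := fun l => hv ▸ Submodule.subset_span ⟨l, rfl⟩
  obtain ⟨p, e, ν, hν, hνv⟩ := exists_homogeneous_generators (veronesePiece 𝒜 n)
    (fun _ => (0 : ℤ)) hvfg (fun i y hy => by
      rw [mem_subSyzygies, subComb_apply] at hy ⊢
      have h2 := congrArg (intProj 𝒜 (u + i * n)) hy
      rw [map_sum, map_zero] at h2
      refine Eq.trans (Finset.sum_congr rfl fun l _ => ?_) h2
      rw [freeProj_apply, coe_intProj, add_zero]
      exact (intProj_mul 𝒜 (d := (u : ℤ)) (hvmem l) _ _).symm)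
  have hβ : ∀ q, ∃ β : Fin m → veronese 𝒜 n, (∀ l, β l ∈ veronesePiece 𝒜 n (i q)) ∧
      subComb (veronese 𝒜 n) v β = c q := by
    intro q
    have h2 := hc q
    rw [hconn.piece_add hgen] at h2
    obtain ⟨β, hβ, hβc⟩ := exists_rightComb_of_mem_mul hv h2
    exact ⟨fun l => ⟨β l, mem_veronese_of_mem 𝒜 n _ (hβ l)⟩, hβ, hβc⟩
  choose β hβ hβc using hβ
  have hkey : ∀ y, subComb (veronese 𝒜 n) v (rightComb (veronese 𝒜 n) β y) =
      subComb (veronese 𝒜 n) c y := by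
    intro y
    rw [subComb_rightComb]
    simp only [hβc]
  -- As c = v β, a vector y is a syzygy of c exactly when β y is a syzygy of v, that is, a
  -- combination of the columns ν. Such y are the first halves of kernel vectors of the joint matrix
  -- (β | ν).
  have hD := h.fg_ker_matrix m (Sum.elim (fun q => (i q : ℤ)) e) (Sum.elim β ν) (by
    rintro (q | t) l
    · exact hβ q l
    · have := hν t l
      rwa [add_zero] at this)
  have hsum : ∀ z, rightComb (veronese 𝒜 n) (Sum.elim β ν) z =
      rightComb (veronese 𝒜 n) β (z ∘ Sum.inl) + rightComb (veronese 𝒜 n) ν (z ∘ Sum.inr) :=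
    fun z => Fintype.sum_sum_type _
  have hmap : subSyzygies (veronese 𝒜 n) c =
      (LinearMap.ker (rightComb (veronese 𝒜 n) (Sum.elim β ν))).map
        (LinearMap.funLeft (veronese 𝒜 n)ᵐᵒᵖ (veronese 𝒜 n) Sum.inl) := by
    ext y
    rw [mem_subSyzygies, ← hkey, ← mem_subSyzygies, ← hνv]
    constructor
    · rintro ⟨z, hz⟩
      refine ⟨Sum.elim y (-z), ?_, rfl⟩
      rw [SetLike.mem_coe, LinearMap.mem_ker, hsum, Sum.elim_comp_inl, Sum.elim_comp_inr, map_neg,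
        hz, add_neg_cancel]
    · rintro ⟨z, hz, rfl⟩
      rw [SetLike.mem_coe, LinearMap.mem_ker, hsum] at hz
      refine ⟨-(z ∘ Sum.inr), ?_⟩
      rw [map_neg]
      exact (eq_neg_of_add_eq_zero_left hz).symm
  rw [hmap]
  exact hD.map _

/-- Over a coherent Veronese subalgebra, the syzygies of a homogeneous family are finitely
generated. -/
theorem HasFGKernels.subSyzygies_fg (h : HasFGKernels (veronesePiece 𝒜 n))
    (hconn : IsConnectedGraded 𝒜) (hgen : GeneratedInDegreeOne 𝒜)
    (hrel : HasFinitelyManyRelations 𝒜) (h1 : (𝒜 1).FG) {ι : Type} [Fintype ι] (e : ι → ℕ)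
    (c : ι → A) (hc : ∀ q, c q ∈ 𝒜 (e q)) : (subSyzygies (veronese 𝒜 n) c).FG := by
  classical
  obtain ⟨m, _, w, -, hw⟩ := hconn.exists_generators_over_veronese (n := n) hgen h1
  -- Entries of other residues are replaced by 0, which lies in every component, so the index set
  -- stays fixed. This leaves their coordinates free in the syzygies, and χ below erases them.
  let cu : ZMod n → ι → A := fun u q => if (e q : ZMod n) = u then c q else 0
  have hfg : ∀ u : ZMod n, (subSyzygies (veronese 𝒜 n) (cu u)).FG := by
    intro u
    obtain ⟨r, v, hv, hvfg⟩ := hconn.exists_spanning_fg_ker hgen hrel h1 u.val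
    have hvmem : ∀ l, v l ∈ 𝒜 u.val := fun l => hv ▸ Submodule.subset_span ⟨l, rfl⟩
    refine h.subSyzygies_fg_of_residue hconn hgen hv ?_ (fun q => e q / n) (cu u) ?_
    · refine fg_of_veroneseRetraction hw hvfg (fun y hy => hy) fun z hz => ?_
      have h2 := congrArg (residueProj 𝒜 n (u.val + 0)) (LinearMap.mem_ker.mp hz)
      rw [rightComb_self_apply, map_sum, map_zero] at h2
      rw [mem_subSyzygies, subComb_apply]
      refine Eq.trans (Finset.sum_congr rfl fun l _ => ?_) h2
      exact (residueProj_mul_left 𝒜 (hvmem l) 0 (z l)).symm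
    · intro q
      change (if (e q : ZMod n) = u then c q else 0) ∈ _
      split_ifs with hq
      · rw [← hq, ZMod.val_natCast, mul_comm, Nat.mod_add_div]
        exact hc q
      · exact zero_mem _
  let χ : ZMod n → (ι → veronese 𝒜 n) →ₗ[(veronese 𝒜 n)ᵐᵒᵖ] (ι → veronese 𝒜 n) := fun u =>
    LinearMap.pi fun q => if (e q : ZMod n) = u then LinearMap.proj q else 0
  have hχ : ∀ u y q, χ u y q = if (e q : ZMod n) = u then y q else 0 := by
    intro u y q
    rw [LinearMap.pi_apply]
    split_ifs <;> rfl
  have hχc : ∀ u y, subComb (veronese 𝒜 n) c (χ u y) = subComb (veronese 𝒜 n) (cu u) y := by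
    intro u y
    refine Finset.sum_congr rfl fun q _ => ?_
    rw [hχ]
    change _ = (if (e q : ZMod n) = u then c q else 0) * _
    split_ifs
    · rfl
    · rw [zero_mul]
      exact mul_zero _
  have hproj : ∀ u y, subComb (veronese 𝒜 n) (cu u) y =
      residueProj 𝒜 n u (subComb (veronese 𝒜 n) c y) := by
    intro u y
    rw [subComb_apply, subComb_apply, map_sum]
    refine Finset.sum_congr rfl fun q _ => ?_
    have h2 := residueProj_mul_left 𝒜 (hc q) (u - (e q : ZMod n)) (y q : A)
    rw [add_sub_cancel, residueProj_of_mem_veronese 𝒜 (y q).2] at h2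
    rw [h2]
    change (if (e q : ZMod n) = u then c q else 0) * _ = _
    simp only [sub_eq_zero, eq_comm (a := u)]
    split_ifs <;> simp
  have hsup : subSyzygies (veronese 𝒜 n) c =
      ⨆ u, (subSyzygies (veronese 𝒜 n) (cu u)).map (χ u) := by
    apply le_antisymm
    · intro y hy
      have h2 : y = ∑ u, χ u y := by
        funext q
        rw [Finset.sum_apply]
        simp only [hχ, Finset.sum_ite_eq, Finset.mem_univ, if_true]
      rw [h2]
      refine Submodule.sum_mem _ fun u _ => Submodule.mem_iSup_of_mem u ⟨y, ?_, rfl⟩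
      rw [SetLike.mem_coe, mem_subSyzygies, hproj, mem_subSyzygies.mp hy, map_zero]
    · refine iSup_le fun u => ?_
      rintro _ ⟨y, hy, rfl⟩
      rw [mem_subSyzygies, hχc]
      exact hy
  rw [hsup]
  exact Submodule.fg_iSup _ fun u => (hfg u).map _

/-- Coherence lifts from the Veronese subalgebra. -/
theorem HasFGKernels.of_veronese (h : HasFGKernels (veronesePiece 𝒜 n))
    (hconn : IsConnectedGraded 𝒜) (hgen : GeneratedInDegreeOne 𝒜)
    (hrel : HasFinitelyManyRelations 𝒜) (h1 : (𝒜 1).FG) : HasFGKernels 𝒜 := by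
  intro r d a ha
  obtain ⟨m, e, w, he, hw⟩ := hconn.exists_generators_over_veronese (n := n) hgen h1
  refine fg_ker_rightComb_of_subSyzygies hw a
    -- For negative `d`, `toNat` gives 0, which is harmless because the corresponding entry of a is
    -- then zero.
    (h.subSyzygies_fg hconn hgen hrel h1 (fun q => (d q.1).toNat + e q.2) _ fun q => ?_)
  refine SetLike.mul_mem_graded ?_ (he q.2)
  have h2 := ha q.1
  revert h2
  cases d q.1 with
  | ofNat i => exact id
  | negSucc i =>
    intro h2
    rw [show a q.1 = 0 from h2]
    exact zero_mem _

end VeroneseGrading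

theorem mainTheorem4 {k A : Type*} [Field k] [Ring A] [Algebra k A]
    (𝒜 : ℕ → Submodule k A) [GradedAlgebra 𝒜]
    (hconn : IsConnectedGraded 𝒜)
    (hgen : GeneratedInDegreeOne 𝒜)
    (hrel : HasFinitelyManyRelations 𝒜)
    (n : ℕ) [NeZero n] :
    IsCoherentGradedAlgebra 𝒜 ↔ IsCoherentGradedAlgebra (veronesePiece 𝒜 n) := by
  rw [hconn.isCoherentGradedAlgebra_iff, hconn.on_veronese.isCoherentGradedAlgebra_iff]
  constructor
  · rintro ⟨h, haug⟩
    have h1 := hconn.piece_one_fg haug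
    have hn : (veronesePiece 𝒜 n 1).FG := by
      rw [veronesePiece_fg_iff, hconn.piece_eq_pow hgen]
      exact h1.pow _
    exact ⟨h.on_veronese hconn hgen h1,
      hconn.on_veronese.augmentationIdeal_fg (hgen.on_veronese hconn) hn⟩
  · rintro ⟨h, haug⟩
    have hn := hconn.on_veronese.piece_one_fg haug
    rw [veronesePiece_fg_iff, one_mul] at hn
    have h1 := hconn.piece_one_fg_of_piece_fg hgen hrel (NeZero.ne n) hn
    exact ⟨h.of_veronese hconn hgen hrel h1, hconn.augmentationIdeal_fg hgen h1⟩
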